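/- Let $N\ge 0$, $1\le k\le N+1$. A network has nodes $0,1,\dots,N+1$, where $0=S$ is the source, $N+1=D$ the destination and $1,\dots,N$ are relays. A set $H$ of relays is dual-mode: in each time-slot, independently, a relay of $H$ is silent with probability $q\in(0,1)$ and active otherwise; all other relays are always active. Each transmitter has power $P$; node $i\le N$ has links to the nodes $j$ with $i<j\le\min(i+k,N+1)$, with power fractions $a_{i,j}>0$, $\sum_j a_{i,j}=1$, distances $d_{i,j}>0$, path loss exponent $\eta$ and noise variance $\sigma^2>0$. Relay $i$ has a buffer of $L_i=\min(k,N+1-i)$ elements. A network state $s_m$ consists of the mode (active/silent) $\lambda_{i,m}\in\{0,1\}$ of each $i\in H$ and of bits $\beta_{i,m}[n]$, $1\le i\le N$, $1\le n\le L_i$, telling which buffer elements are non-empty. In state $s_m$ node $0$ transmits to nodes $1,\dots,k$, and relay $i$ transmits to node $j$ iff $i<j\le i+L_i$, $\beta_{i,m}[j-i]=1$ and relay $i$ is not silent. These links form the network instance of $s_m$. The outage probability of node $j$ in state $s_m$ is $$P_o(j,m)=\mathbb P\Big[\tfrac{P}{\sigma^2}\Big(\sum_{i\to j\text{ in }s_m}|h_{i,j}|\sqrt{d_{i,j}^{-\eta}a_{i,j}}\Big)^2<\gamma\Big],\qquad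 h_{i,j}\text{ i.i.d. }\mathcal{CN}(0,1).$$ The states form a Markov chain: a transition $s_m\to s_l$ is possible only if $\beta_{i,l}[n+1]=\beta_{i,m}[n]$ for all $i$ and $1\le n<L_i$, and then has probability $$\prod_{i\in H}\big[\lambda_{i,l}(1-q)+(1-\lambda_{i,l})q\big]\ \prod_{j=1}^{N}\big[\beta_{j,l}[1](1-P_o(j,m))+(1-\beta_{j,l}[1])P_o(j,m)\big].$$ Let $\boldsymbol\pi=\boldsymbol\pi(P)$ be its stationary distribution and $P_{out}=\sum_m\boldsymbol\pi_mP_o(N+1,m)$ the outage probability of the system. Let $\rho\in[0,1]$, and let the threshold $\gamma=\gamma(P)$ be bounded below by a positive constant for large $P$ and such that the target rate $R(P)=\log(1+\gamma(P))$ satisfies $\lim_{P\to\infty}R(P)/\log P=\rho$. Then $P_{out}>0$ for all large $P$, and the diversity gain is $$\delta^*(\rho)=\lim_{P\to\infty}-\frac{\log P_{out}}{\log P}=(1-\rho)\min_{m:\ \boldsymbol\pi_m\nrightarrow0}\mathcal L_m ,$$ where the minimum is over the network states whose stationary probability does not tend to $0$ as $P\to\infty$, and $\mathcal L_m$ is the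 number of edge-disjoint paths from $S$ to $D$ (the maximal size of a family of pairwise edge-disjoint directed paths) in the network instance of $s_m$. The same formula holds when $\mathcal L_m$ is computed in the network instance of $s_m$ with all dual-mode relays omitted. -/

import Mathlib

open Filter Topology MeasureTheory ProbabilityTheory

/-- The circularly symmetric complex Gaussian law `CN(0,1)`: real and imaginary parts are independent
centred real Gaussians of variance `1/2`. -/
noncomputable def complexGaussian : Measure ℂ :=
  ((gaussianReal 0 (1 / 2)).prod (gaussianReal 0 (1 / 2))).map Complex.measurableEquivRealProd.symm

instance complexGaussian_isProbabilityMeasure : IsProbabilityMeasure complexGaussian :=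
  Measure.isProbabilityMeasure_map Complex.measurableEquivRealProd.symm.measurable.aemeasurable

section DisjointPaths

variable {V : Type*}

/-- `p` is the list of vertices of a directed path from `u` to `v` along links of `E`. -/
def IsDirectedPath (E : V → V → Prop) (u v : V) (p : List V) : Prop :=
  p.head? = some u ∧ p.getLast? = some v ∧ p.IsChain E ∧ p.Nodup

/-- The list of links (pairs of consecutive vertices) of a path. -/
def pathLinks (p : List V) : List (V × V) := p.zip p.tail

/-- There are `n` pairwise edge-disjoint directed paths from `u` to `v` along links of `E`. -/
def HasEdgeDisjointPaths (E : V → V → Prop) (u v : V) (n : ℕ) : Prop :=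
  ∃ p : Fin n → List V, (∀ a, IsDirectedPath E u v (p a)) ∧
    ∀ a b, a ≠ b → (pathLinks (p a)).Disjoint (pathLinks (p b))

/-- The number of edge-disjoint directed paths from `u` to `v`: the largest size of a family of
pairwise edge-disjoint paths (on a finite vertex set and for `u ≠ v` these sizes are bounded). -/
noncomputable def numEdgeDisjointPaths (E : V → V → Prop) (u v : V) : ℕ :=
  sSup {n | HasEdgeDisjointPaths E u v n}

end DisjointPaths

/-- The parameters of a multi-hop network with a `k`-hop myopic decode-and-forward protocol.
The nodes are `0, …, N + 1`: node `0` is the source `S`, node `N + 1` the destination `D`, and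
node `r + 1` is the relay with index `r : Fin N`. -/
structure MyopicNetwork where
  /-- number of relays -/
  N : ℕ
  /-- number of hops -/
  k : ℕ
  one_le_k : 1 ≤ k
  k_le : k ≤ N + 1
  /-- set of dual-mode relays; all other relays are always active -/
  H : Finset (Fin N)
  /-- probability that a dual-mode relay is silent in a time-slot -/
  q : ℝ
  q_pos : 0 < q
  q_lt_one : q < 1
  /-- power splitting parameters -/
  a : Fin (N + 2) → Fin (N + 2) → ℝ
  a_pos : ∀ i j : Fin (N + 2), i < j → (j : ℕ) ≤ i + k → 0 < a i j
  a_sum : ∀ i : Fin (N + 2), (i : ℕ) ≤ N →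
    ∑ j : Fin (N + 2) with i < j ∧ (j : ℕ) ≤ i + k, a i j = 1
  /-- distances between the nodes -/
  d : Fin (N + 2) → Fin (N + 2) → ℝ
  d_pos : ∀ i j : Fin (N + 2), i < j → 0 < d i j
  /-- path loss exponent -/
  η : ℝ
  /-- standard deviation of the noise -/
  σ : ℝ
  σ_pos : 0 < σ

namespace MyopicNetwork

variable (W : MyopicNetwork)

/-- The nodes `0, …, N + 1`. -/
abbrev Node : Type := Fin (W.N + 2)

/-- The source `S`. -/
def src : W.Node := 0

/-- The destination `D`. -/
def dst : W.Node := Fin.last (W.N + 1)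

/-- The node of the relay with index `r`. -/
def relay (r : Fin W.N) : W.Node := ⟨r + 1, by omega⟩

/-- Buffer size `min (k, N - i + 1)` of the relay at node `i = r + 1`. -/
def bufLen (r : Fin W.N) : ℕ := min W.k (W.N - r)

theorem bufLen_pos (r : Fin W.N) : 0 < W.bufLen r := by
  have := W.one_le_k
  have := r.isLt
  unfold bufLen
  omega

/-- Network states: `s.1` gives the mode of every dual-mode relay (`true` is active, `false` is
silent), and `s.2 r n` tells whether element `n + 1` of the buffer of relay `r` is non-empty. -/
abbrev State : Type := (W.H → Bool) × ((r : Fin W.N) → Fin (W.bufLen r) → Bool)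

variable {W}

/-- Node `i` transmits to node `j` in state `s`: the source transmits to nodes `1, …, k`; a relay
`i` transmits to `j = i + n` if element `n` of its buffer is non-empty and, in case it is a dual-mode
relay, it is active. This relation is the network instance of the state `s`. -/
def Transmits (s : W.State) (i j : W.Node) : Prop :=
  (i = W.src ∧ 1 ≤ (j : ℕ) ∧ (j : ℕ) ≤ W.k) ∨
    ∃ (r : Fin W.N) (n : Fin (W.bufLen r)),
      i = W.relay r ∧ (j : ℕ) = (i : ℕ) + (n + 1) ∧ s.2 r n = true ∧
        ∀ h : r ∈ W.H, s.1 ⟨r, h⟩ = true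

/-- Node `i` is a dual-mode relay. -/
def IsDual (i : W.Node) : Prop := ∃ r ∈ W.H, i = W.relay r

/-- The network instance of the state `s` with the dual-mode relays omitted. -/
def TransmitsSurely (s : W.State) (i j : W.Node) : Prop :=
  Transmits s i j ∧ ¬ IsDual i ∧ ¬ IsDual j

variable (W)

open Classical in
/-- The SNR at node `j` in state `s` with transmit power `P`, where `h i` is the fading coefficient
of the link from `i` to `j`. -/
noncomputable def snr (P : ℝ) (s : W.State) (j : W.Node) (h : W.Node → ℂ) : ℝ :=
  P / W.σ ^ 2 *
    (∑ i : W.Node, if Transmits s i j then ‖h i‖ * √(W.d i j ^ (-W.η) * W.a i j) else 0) ^ 2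

/-- The probability of an outage (SNR below the threshold `γ`) at node `j` in state `s`; the fading
coefficients of the links into `j` are i.i.d. `CN(0,1)`. -/
noncomputable def outage (P γ : ℝ) (j : W.Node) (s : W.State) : ℝ :=
  (Measure.pi fun _ : W.Node => complexGaussian).real {h | W.snr P s j h < γ}

variable {W} in
/-- The contents of the buffers in `l` are those in `m`, shifted by one position, except for the
first elements. -/
def ShiftCompatible (m l : W.State) : Prop :=
  ∀ (r : Fin W.N) (n n' : Fin (W.bufLen r)), (n' : ℕ) = n + 1 → l.2 r n' = m.2 r n

open Classical in
/-- The (column stochastic) transition matrix: the entry `(l, m)` is the probability of the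
transition from the state `m` to the state `l`. -/
noncomputable def transitionMatrix (P γ : ℝ) : Matrix W.State W.State ℝ := fun l m =>
  if ShiftCompatible m l then
    (∏ i : W.H, if l.1 i = true then 1 - W.q else W.q) *
      ∏ r : Fin W.N, if l.2 r ⟨0, W.bufLen_pos r⟩ = true
        then 1 - W.outage P γ (W.relay r) m else W.outage P γ (W.relay r) m
  else 0

variable {W} in
/-- `p` is a stationary distribution of the column stochastic matrix `A`. -/
def IsStationary (A : Matrix W.State W.State ℝ) (p : W.State → ℝ) : Prop :=
  (∀ m, 0 ≤ p m) ∧ ∑ m, p m = 1 ∧ A.mulVec p = p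

/-- The outage probability of the system when the network states have the distribution `p`. -/
noncomputable def systemOutage (P γ : ℝ) (p : W.State → ℝ) : ℝ :=
  ∑ m, p m * W.outage P γ W.dst m

end MyopicNetwork

/-! Put `ε = min 1 (γ / P)`. A sum of `t` independent fading gains is small enough for an outage
with probability of order `ε ^ t`. Call a link of length at most `k` a core link if its tail is not
a dual-mode relay, and let `coreNum` be the number of edge-disjoint core paths from source to
destination. The heart of the proof is that the system outage is of order `ε ^ coreNum`
(`systemOutage_bounds`).

Follow one packet. The node `N + 1 - t` receives it `t` slots before the destination does, so
stationarity is unrolled over about `N` slots, after which the initial buffers are irrelevant. If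
`X` is the set of nodes that obtain the packet, the others fail with probability at most of order
`ε` to the number of core links leaving `X`. Every cut has at least `coreNum` such links, which
bounds the outage from above (`laterOutage_mul_le`). Conversely, by Menger's theorem
(`exists_cutSize_le_num`) some cut has at most `coreNum` links, and its failure, with all dual-mode
relays silent in every slot, has probability at least of this order (`mul_le_laterOutage`).

It remains to identify `coreNum` with the minimum over states. If `ρ < 1` then `ε → 0`, and a state
whose probability does not vanish has full buffers at all relays reachable along core links, so all
core paths are present in it. The silent states have total mass `q ^ #H`, so one of them does not
vanish, and it has no other links. If `ρ = 1` both sides are `0`. -/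

section EdgeMenger

/-! ### Unit flows and the edge version of Menger's theorem on acyclic networks -/

variable {V : Type*}

@[simp] theorem pathLinks_singleton (a : V) : pathLinks [a] = [] := rfl

@[simp] theorem pathLinks_cons_cons (a b : V) (l : List V) :
    pathLinks (a :: b :: l) = (a, b) :: pathLinks (b :: l) := rfl

theorem nodup_pathLinks {p : List V} (h : p.Nodup) : (pathLinks p).Nodup := by
  apply List.Nodup.of_map Prod.snd
  rw [pathLinks, List.map_snd_zip (by simp)]
  exact h.tail

theorem rel_of_mem_pathLinks {R : V → V → Prop} : ∀ {p : List V}, p.IsChain R →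
    ∀ {u v : V}, (u, v) ∈ pathLinks p → R u v
  | [], _, _, _, h => by simp [pathLinks] at h
  | [a], _, _, _, h => by simp at h
  | a :: b :: l, hc, u, v, h => by
    rw [List.isChain_cons_cons] at hc
    rw [pathLinks_cons_cons, List.mem_cons] at h
    rcases h with h | h
    · cases h
      exact hc.1
    · exact rel_of_mem_pathLinks hc.2 h

/-- A path that starts in `X` and ends outside `X` uses a link leaving `X`. -/
theorem exists_crossing_link {X : Set V} {t : V} (ht : t ∉ X) : ∀ {p : List V} {s : V},
    p.head? = some s → p.getLast? = some t → s ∈ X → ∃ u v, (u, v) ∈ pathLinks p ∧ u ∈ X ∧ v ∉ X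
  | [], _, h, _, _ => by simp at h
  | [a], _, h, h', hs => by
    simp only [List.head?_cons, Option.some.injEq, List.getLast?_singleton] at h h'
    subst h h'
    exact absurd hs ht
  | a :: b :: l, _, h, h', hs => by
    simp only [List.head?_cons, Option.some.injEq] at h
    subst h
    by_cases hb : b ∈ X
    · obtain ⟨u, v, huv, hu⟩ := exists_crossing_link ht (p := b :: l) rfl
        (by simpa using h') hb
      exact ⟨u, v, by simp [huv], hu⟩
    · exact ⟨a, b, by simp, hs, hb⟩

open Classical in
/-- The unit flow along a path. -/
noncomputable def pathFlow (p : List V) (u v : V) : ℤ :=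
  (pathLinks p).count (u, v) - (pathLinks p).count (v, u)

theorem pathFlow_antisymm (p : List V) (u v : V) : pathFlow p u v = - pathFlow p v u := by
  simp [pathFlow]

open Classical in
theorem count_pathLinks_cases {p : List V} (hp : p.Nodup) (e : V × V) :
    (e ∈ pathLinks p ∧ (pathLinks p).count e = 1) ∨
      (e ∉ pathLinks p ∧ (pathLinks p).count e = 0) := by
  by_cases h : e ∈ pathLinks p
  · exact Or.inl ⟨h, List.count_eq_one_of_mem (nodup_pathLinks hp) h⟩
  · exact Or.inr ⟨h, List.count_eq_zero_of_not_mem h⟩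

theorem exists_path_of_reflTransGen {R : V → V → Prop} {s t : V} (h : Relation.ReflTransGen R s t) :
    ∃ p, IsDirectedPath R s t p := by
  induction h with
  | refl => exact ⟨[s], by simp [IsDirectedPath]⟩
  | @tail x y _ hxy ih =>
    obtain ⟨p, h1, h2, h3, h4⟩ := ih
    -- If the new vertex is already on the path, the path is cut off there; this keeps it simple.
    by_cases hy : y ∈ p
    · obtain ⟨l₁, l₂, rfl⟩ := List.append_of_mem hy
      have e : l₁ ++ y :: l₂ = (l₁ ++ [y]) ++ l₂ := by simp
      rw [e] at h3 h4
      refine ⟨l₁ ++ [y], ?_, by simp, h3.left_of_append, h4.of_append_left⟩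
      cases l₁ <;> simpa using h1
    · refine ⟨p ++ [y], ?_, by simp, ?_, ?_⟩
      · simp [h1]
      · rw [List.isChain_append]
        refine ⟨h3, by simp, ?_⟩
        intro a ha b hb
        simp_all
      · simp [List.nodup_append, h4]
        rintro a ha rfl
        exact hy ha

theorem hasEdgeDisjointPaths_zero (E : V → V → Prop) (s t : V) : HasEdgeDisjointPaths E s t 0 :=
  ⟨Fin.elim0, fun a => a.elim0, fun a => a.elim0⟩

variable [Fintype V]

open Classical in
/-- The number of links of `E` from `X` to its complement. -/
noncomputable def cutSize (E : V → V → Prop) (X : Finset V) : ℕ :=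
  ∑ v ∈ Xᶜ, (X.filter fun u => E u v).card

/-- Each path crosses the cut along some link, and disjointness makes the choice of this link
injective. -/
theorem HasEdgeDisjointPaths.le_cutSize {E : V → V → Prop} {s t : V} {n : ℕ}
    (h : HasEdgeDisjointPaths E s t n) {X : Finset V} (hs : s ∈ X) (ht : t ∉ X) :
    n ≤ cutSize E X := by
  classical
  obtain ⟨p, hp, hd⟩ := h
  have key : ∀ a, ∃ e : V × V, e ∈ pathLinks (p a) ∧ e.1 ∈ X ∧ e.2 ∉ X := fun a => by
    obtain ⟨u, v, h1, h2, h3⟩ := exists_crossing_link (X := (X : Set V)) (by simpa using ht)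
      (hp a).1 (hp a).2.1 (by simpa using hs)
    exact ⟨(u, v), h1, by simpa using h2, by simpa using h3⟩
  choose e he h1 h2 using key
  have hcard : cutSize E X = (Xᶜ.sigma fun v => X.filter fun u => E u v).card := by
    rw [Finset.card_sigma, cutSize]
  rw [hcard]
  calc n = (Finset.univ : Finset (Fin n)).card := by simp
    _ ≤ _ := by
      refine Finset.card_le_card_of_injOn (fun a => (⟨(e a).2, (e a).1⟩ : Σ _ : V, V)) ?_ ?_
      · intro a _
        have := rel_of_mem_pathLinks (hp a).2.2.1 (u := (e a).1) (v := (e a).2) (he a)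
        simp [h1 a, h2 a, this]
      · intro a _ b _ hab
        by_contra hne
        simp only [Sigma.mk.injEq, heq_eq_eq] at hab
        have : e a = e b := Prod.ext hab.2 hab.1
        exact hd a b hne (he a) (this ▸ he b)

theorem bddAbove_hasEdgeDisjointPaths (E : V → V → Prop) {s t : V} (hst : s ≠ t) :
    BddAbove {n | HasEdgeDisjointPaths E s t n} :=
  ⟨cutSize E {s}, fun _ h => h.le_cutSize (by simp) (by simpa using hst.symm)⟩

theorem HasEdgeDisjointPaths.le_num {E : V → V → Prop} {s t : V} (hst : s ≠ t) {n : ℕ}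
    (h : HasEdgeDisjointPaths E s t n) : n ≤ numEdgeDisjointPaths E s t :=
  le_csSup (bddAbove_hasEdgeDisjointPaths E hst) h

theorem hasEdgeDisjointPaths_num (E : V → V → Prop) {s t : V} (hst : s ≠ t) :
    HasEdgeDisjointPaths E s t (numEdgeDisjointPaths E s t) :=
  Nat.sSup_mem ⟨0, hasEdgeDisjointPaths_zero E s t⟩ (bddAbove_hasEdgeDisjointPaths E hst)

/-- The number of edge-disjoint paths is monotone in the set of directed paths. -/
theorem numEdgeDisjointPaths_le_of_path {E F : V → V → Prop} {s t : V} (hst : s ≠ t)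
    (h : ∀ p, IsDirectedPath E s t p → IsDirectedPath F s t p) :
    numEdgeDisjointPaths E s t ≤ numEdgeDisjointPaths F s t := by
  obtain ⟨p, hp, hd⟩ := hasEdgeDisjointPaths_num E hst
  exact HasEdgeDisjointPaths.le_num hst ⟨p, fun a => h _ (hp a), hd⟩

theorem numEdgeDisjointPaths_mono {E F : V → V → Prop} {s t : V} (hst : s ≠ t)
    (h : ∀ u v, E u v → F u v) :
    numEdgeDisjointPaths E s t ≤ numEdgeDisjointPaths F s t :=
  numEdgeDisjointPaths_le_of_path hst fun _ hp =>
    ⟨hp.1, hp.2.1, hp.2.2.1.imp fun _ _ => h _ _, hp.2.2.2⟩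

open Classical in
/-- Integral flows from `s` to `t` for unit capacities on the links of `E`, in antisymmetric form. -/
structure IsUnitFlow (E : V → V → Prop) (s t : V) (g : V → V → ℤ) : Prop where
  antisymm : ∀ u v, g u v = - g v u
  le_cap : ∀ u v, g u v ≤ if E u v then 1 else 0
  conserve : ∀ u, u ≠ s → u ≠ t → ∑ v, g u v = 0

-- The sum telescopes along the path: prepending a vertex moves the unit source to it. This is what
-- keeps conservation when a path is added to a flow or removed from it.
open Classical in
theorem sum_pathFlow (u b : V) : ∀ (l : List V) (a : V), (a :: l).getLast? = some b →
    ∑ v, pathFlow (a :: l) u v = (if u = a then 1 else 0) - (if u = b then 1 else 0)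
  | [], a, h => by
    simp only [List.getLast?_singleton, Option.some.injEq] at h
    simp [pathFlow, h]
  | c :: l, a, h => by
    have ih := sum_pathFlow u b l c (by simpa using h)
    have step : ∀ v, pathFlow (a :: c :: l) u v =
        (if u = a then (if v = c then 1 else 0) else 0)
          - (if u = c then (if v = a then 1 else 0) else 0) + pathFlow (c :: l) u v := by
      intro v
      simp only [pathFlow, pathLinks_cons_cons, List.count_cons, beq_iff_eq, Prod.mk.injEq,
        Nat.cast_add]
      by_cases h1 : u = a <;> by_cases h2 : v = c <;> by_cases h3 : u = c <;>
        by_cases h4 : v = a <;> simp_all [eq_comm] <;> ring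
    simp only [step, Finset.sum_add_distrib, Finset.sum_sub_distrib, ih]
    split_ifs <;> simp

theorem IsUnitFlow.rel_of_pos {E : V → V → Prop} {s t : V} {g : V → V → ℤ}
    (hg : IsUnitFlow E s t g) {u v : V} (h : 0 < g u v) : E u v := by
  by_contra hE
  have := hg.le_cap u v
  rw [if_neg hE] at this
  omega

theorem IsUnitFlow.le_one {E : V → V → Prop} {s t : V} {g : V → V → ℤ}
    (hg : IsUnitFlow E s t g) (u v : V) : g u v ≤ 1 := by
  have := hg.le_cap u v
  split_ifs at this <;> omega

theorem IsUnitFlow.sum_add_pathFlow {E : V → V → Prop} {s t : V} (hst : s ≠ t) {g : V → V → ℤ}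
    (hg : IsUnitFlow E s t g) {p : List V} (hh : p.head? = some s) (hl : p.getLast? = some t)
    (z : ℤ) :
    (∀ u, u ≠ s → u ≠ t → ∑ v, (g u v + z * pathFlow p u v) = 0) ∧
      ∑ v, (g s v + z * pathFlow p s v) = ∑ v, g s v + z := by
  obtain ⟨l, rfl⟩ : ∃ l, p = s :: l := by
    cases p with
    | nil => simp at hh
    | cons a l => exact ⟨l, by simp_all⟩
  constructor
  · intro u h1 h2
    rw [Finset.sum_add_distrib, ← Finset.mul_sum, sum_pathFlow u t l s hl, hg.conserve u h1 h2]
    simp [h1, h2]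
  · rw [Finset.sum_add_distrib, ← Finset.mul_sum, sum_pathFlow s t l s hl]
    simp [hst]

/-- Augmentation along a simple path of links with residual capacity. -/
theorem IsUnitFlow.augment {E : V → V → Prop} {s t : V} (hst : s ≠ t) {g : V → V → ℤ}
    (hg : IsUnitFlow E s t g) {p : List V}
    (hp : IsDirectedPath (fun u v => g u v < open Classical in if E u v then 1 else 0) s t p) :
    ∃ g', IsUnitFlow E s t g' ∧ ∑ v, g' s v = ∑ v, g s v + 1 := by
  classical
  obtain ⟨h1, h2, h3, h4⟩ := hp
  have hsum := hg.sum_add_pathFlow hst h1 h2 1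
  refine ⟨fun u v => g u v + 1 * pathFlow p u v, ⟨fun u v => ?_, fun u v => ?_, hsum.1⟩, hsum.2⟩
  · rw [hg.antisymm u v, pathFlow_antisymm]
    ring
  · have hc := hg.le_cap u v
    have hr : (u, v) ∈ pathLinks p → _ := fun h => rel_of_mem_pathLinks h3 h
    rcases count_pathLinks_cases h4 (u, v) with ⟨ha, hb⟩ | ⟨ha, hb⟩
    · have := hr ha
      simp only [pathFlow, hb]
      have h0 : (0 : ℤ) ≤ ((pathLinks p).count (v, u) : ℤ) := by positivity
      split_ifs at this ⊢ <;> omega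
    · simp only [pathFlow, hb]
      have h0 : (0 : ℤ) ≤ ((pathLinks p).count (v, u) : ℤ) := by positivity
      split_ifs at hc ⊢ <;> omega

variable [LinearOrder V]

/-- A vertex other than `t` that is entered by positive flow is also left by positive flow, by
conservation; at `s` the positive value plays this role. Links increase, so the walk stops, and it
can only stop at `t`. -/
theorem IsUnitFlow.exists_path {E : V → V → Prop} (hE : ∀ u v, E u v → u < v) {s t : V}
    {g : V → V → ℤ} (hg : IsUnitFlow E s t g) (hpos : 0 < ∑ v, g s v) (v : V) (hsv : s ≤ v)
    (hv : v = s ∨ ∃ w, 0 < g w v) :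
    ∃ l : List V, (v :: l).getLast? = some t ∧ (v :: l).IsChain (fun u w => 0 < g u w) := by
  induction v using WellFoundedGT.induction with
  | ind v ih =>
    by_cases hvt : v = t
    · exact ⟨[], by simp [hvt]⟩
    have hout : ∃ u, 0 < g v u := by
      by_contra hno
      push Not at hno
      by_cases hvs : v = s
      · subst hvs
        have : ∑ u, g v u ≤ 0 := Finset.sum_nonpos fun u _ => hno u
        omega
      · obtain ⟨w, hw⟩ := hv.resolve_left hvs
        have h1 := hg.conserve v hvs hvt
        have h2 := (Finset.sum_eq_zero_iff_of_nonpos fun u _ => hno u).1 h1 w (Finset.mem_univ w)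
        rw [hg.antisymm] at h2
        omega
    obtain ⟨u, hu⟩ := hout
    have hlt := hE _ _ (hg.rel_of_pos hu)
    obtain ⟨l, h1, h2⟩ := ih u hlt (hsv.trans hlt.le) (Or.inr ⟨v, hu⟩)
    exact ⟨u :: l, by simpa using h1, by simp [hu, h2]⟩

/-- Path decomposition of an integral flow on an acyclic network. -/
theorem IsUnitFlow.decompose {E : V → V → Prop} (hE : ∀ u v, E u v → u < v) {s t : V}
    (hst : s ≠ t) : ∀ (n : ℕ) (g : V → V → ℤ), IsUnitFlow E s t g → ∑ v, g s v = n →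
    ∃ p : Fin n → List V, (∀ a, IsDirectedPath (fun u w => 0 < g u w) s t (p a)) ∧
      ∀ a b, a ≠ b → (pathLinks (p a)).Disjoint (pathLinks (p b))
  | 0, _, _, _ => ⟨Fin.elim0, fun a => a.elim0, fun a => a.elim0⟩
  | n + 1, g, hg, hval => by
    classical
    obtain ⟨l, hl, hc⟩ := hg.exists_path hE (by rw [hval]; positivity) s le_rfl (Or.inl rfl)
    set p := s :: l with hpdef
    have hnd : p.Nodup :=
      ((hc.imp fun u w h => hE _ _ (hg.rel_of_pos h)).pairwise).imp fun h => h.ne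
    have hsum := hg.sum_add_pathFlow hst (p := p) rfl hl (-1)
    have hon : ∀ u v, (u, v) ∈ pathLinks p → 0 < g u v := fun u v h => rel_of_mem_pathLinks hc h
    have hg' : IsUnitFlow E s t (fun u v => g u v + -1 * pathFlow p u v) := by
      refine ⟨fun u v => ?_, fun u v => ?_, hsum.1⟩
      · rw [hg.antisymm u v, pathFlow_antisymm]
        ring
      · have hc := hg.le_cap u v
        have h1 := hon v u
        have ha := hg.antisymm u v
        simp only [pathFlow]
        rcases count_pathLinks_cases hnd (v, u) with ⟨hm, hb⟩ | ⟨hm, hb⟩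
        · have := h1 hm
          rw [hb]
          split_ifs <;> omega
        · rw [hb]
          split_ifs at hc ⊢ <;> omega
    -- Capacities are one, so subtracting the path exhausts its links, and no reversed link becomes
    -- positive. The remaining paths therefore avoid it.
    have hlt : ∀ u v, 0 < g u v + -1 * pathFlow p u v → 0 < g u v ∧ (u, v) ∉ pathLinks p := by
      intro u v h
      have h1 := hon v u
      have h2 := hon u v
      have ha := hg.antisymm u v
      have hc1 := hg.le_one u v
      have hc2 := hg.le_one v u
      simp only [pathFlow] at h
      rcases count_pathLinks_cases hnd (v, u) with ⟨hm, hb⟩ | ⟨hm, hb⟩ <;>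
        rcases count_pathLinks_cases hnd (u, v) with ⟨hm', hb'⟩ | ⟨hm', hb'⟩ <;>
          simp only [hb, hb', hm, hm', true_implies] at h h1 h2 ⊢ <;>
            simp only [not_true_eq_false, not_false_eq_true, and_true, and_false] <;> omega
    obtain ⟨ps, hps, hdis⟩ := IsUnitFlow.decompose hE hst n _ hg'
      (by rw [hsum.2, hval]; push_cast; ring)
    have hpd : ∀ a, (pathLinks p).Disjoint (pathLinks (ps a)) := fun a e h1 h2 =>
      (hlt e.1 e.2 (rel_of_mem_pathLinks (hps a).2.2.1 h2)).2 h1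
    refine ⟨Fin.cons p ps, fun a => ?_, fun a b hab => ?_⟩
    · induction a using Fin.cases with
      | zero => exact ⟨rfl, hl, hc, hnd⟩
      | succ a => exact ⟨(hps a).1, (hps a).2.1,
          (hps a).2.2.1.imp fun u v h => (hlt u v h).1, (hps a).2.2.2⟩
    · induction a using Fin.cases with
      | zero =>
        induction b using Fin.cases with
        | zero => exact absurd rfl hab
        | succ b => exact hpd b
      | succ a =>
        induction b using Fin.cases with
        | zero => exact (hpd a).symm
        | succ b => exact hdis a b fun h => hab (by rw [h])

theorem IsUnitFlow.hasEdgeDisjointPaths {E : V → V → Prop} (hE : ∀ u v, E u v → u < v) {s t : V}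
    (hst : s ≠ t) {n : ℕ} {g : V → V → ℤ} (hg : IsUnitFlow E s t g) (hval : ∑ v, g s v = n) :
    HasEdgeDisjointPaths E s t n := by
  obtain ⟨p, hp, hd⟩ := IsUnitFlow.decompose hE hst n g hg hval
  exact ⟨p, fun a => ⟨(hp a).1, (hp a).2.1,
    (hp a).2.2.1.imp fun u v h => hg.rel_of_pos h, (hp a).2.2.2⟩, hd⟩

/-- The edge version of Menger's theorem on an acyclic network. -/
theorem exists_cutSize_le_num {E : V → V → Prop} (hE : ∀ u v, E u v → u < v) {s t : V}
    (hst : s ≠ t) : ∃ X : Finset V, s ∈ X ∧ t ∉ X ∧ cutSize E X ≤ numEdgeDisjointPaths E s t := by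
  classical
  let Q : ℕ → Prop := fun n => ∃ g, IsUnitFlow E s t g ∧ ∑ v, g s v = n
  have hQ0 : Q 0 := ⟨fun _ _ => 0, ⟨by simp, fun u v => by split_ifs <;> simp, by simp⟩, by simp⟩
  have hQle : ∀ n, Q n → n ≤ numEdgeDisjointPaths E s t := fun n ⟨g, hg, hv⟩ =>
    (hg.hasEdgeDisjointPaths hE hst hv).le_num hst
  -- Path decomposition bounds the flow values, so there is a maximal integral flow. The cut
  -- consists of the vertices reachable from `s` in its residual network.
  obtain ⟨n, ⟨g, hg, hv⟩, hmax⟩ : ∃ n, Q n ∧ ∀ m, Q m → m ≤ n :=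
    ⟨_, Nat.findGreatest_spec (P := Q) (Nat.zero_le _) hQ0,
      fun m hm => Nat.le_findGreatest (hQle m hm) hm⟩
  set R : V → V → Prop := fun u v => g u v < if E u v then 1 else 0 with hR
  have htR : ¬ Relation.ReflTransGen R s t := by
    intro h
    obtain ⟨p, hp⟩ := exists_path_of_reflTransGen h
    obtain ⟨g', hg', hv'⟩ := hg.augment hst hp
    have := hmax (n + 1) ⟨g', hg', by rw [hv', hv]; push_cast; ring⟩
    omega
  set X : Finset V := Finset.univ.filter fun v => Relation.ReflTransGen R s v with hX
  have hsX : s ∈ X := by simp [hX, Relation.ReflTransGen.refl]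
  have htX : t ∉ X := by simpa [hX] using htR
  refine ⟨X, hsX, htX, le_trans (le_of_eq ?_) (hQle n ⟨g, hg, hv⟩)⟩
  have hsat : ∀ u ∈ X, ∀ v ∈ Xᶜ, g u v = if E u v then 1 else 0 := by
    intro u hu v hv
    by_contra hne
    have hres : R u v := lt_of_le_of_ne (hg.le_cap u v) hne
    simp only [hX, Finset.mem_filter, Finset.mem_univ, true_and, Finset.mem_compl] at hu hv
    exact hv (hu.tail hres)
  have h1 : ∑ u ∈ X, ∑ v, g u v = n := by
    rw [← hv]
    refine Finset.sum_eq_single_of_mem s hsX fun u hu hus => hg.conserve u hus ?_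
    rintro rfl
    exact htX hu
  -- By antisymmetry the flow inside `X` cancels, so the value is the flow across the cut, where all
  -- links are saturated.
  have h2 : ∑ u ∈ X, ∑ v ∈ X, g u v = 0 := by
    have : ∑ u ∈ X, ∑ v ∈ X, g u v = - ∑ u ∈ X, ∑ v ∈ X, g u v := by
      conv_lhs => rw [Finset.sum_comm]
      rw [← Finset.sum_neg_distrib]
      refine Finset.sum_congr rfl fun u _ => ?_
      rw [← Finset.sum_neg_distrib]
      exact Finset.sum_congr rfl fun v _ => hg.antisymm v u
    omega
  have h3 : (cutSize E X : ℤ) = ∑ u ∈ X, ∑ v ∈ Xᶜ, g u v := by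
    have h : cutSize E X = ∑ v ∈ Xᶜ, (X.filter fun u => E u v).card := by
      unfold cutSize
      congr!
    rw [Finset.sum_comm, h]
    push_cast
    refine Finset.sum_congr rfl fun v hv => ?_
    rw [Finset.sum_congr rfl fun u hu => hsat u hu v hv]
    simp
  have h4 : ∑ u ∈ X, ∑ v, g u v = ∑ u ∈ X, ∑ v ∈ X, g u v + ∑ u ∈ X, ∑ v ∈ Xᶜ, g u v := by
    rw [← Finset.sum_add_distrib]
    exact Finset.sum_congr rfl fun u _ => (Finset.sum_add_sum_compl X _).symm
  omega

end EdgeMenger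

/-! ### Small-ball probabilities of Gaussian fading gains -/

section SmallBall

/-- The density is largest at `0`. -/
theorem gaussianReal_Ioo_le {r : ℝ} (hr : 0 ≤ r) :
    (gaussianReal 0 (1 / 2)).real (Set.Ioo (-r) r) ≤ gaussianPDFReal 0 (1 / 2) 0 * (2 * r) := by
  have hM := gaussianPDFReal_nonneg 0 (1 / 2) 0
  apply ENNReal.toReal_le_of_le_ofReal (by positivity)
  rw [gaussianReal_apply 0 (by norm_num)]
  calc ∫⁻ x in Set.Ioo (-r) r, gaussianPDF 0 (1 / 2) x
      ≤ ∫⁻ x in Set.Ioo (-r) r, ENNReal.ofReal (gaussianPDFReal 0 (1 / 2) 0) := by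
        refine lintegral_mono fun x => ENNReal.ofReal_le_ofReal ?_
        unfold gaussianPDFReal
        refine mul_le_mul_of_nonneg_left (Real.exp_le_exp.2 ?_) (by positivity)
        norm_num
        positivity
    _ = _ := by
        rw [setLIntegral_const, Real.volume_Ioo, ← ENNReal.ofReal_mul hM]
        ring_nf

/-- On `[-1, 1]` the density is at least its value at `1`. -/
theorem le_gaussianReal_Ioo {r : ℝ} (hr1 : r ≤ 1) :
    gaussianPDFReal 0 (1 / 2) 1 * (2 * r) ≤ (gaussianReal 0 (1 / 2)).real (Set.Ioo (-r) r) := by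
  have hM := gaussianPDFReal_nonneg 0 (1 / 2) 1
  apply (ENNReal.ofReal_le_iff_le_toReal (measure_ne_top _ _)).1
  rw [gaussianReal_apply 0 (by norm_num)]
  calc _ = ∫⁻ x in Set.Ioo (-r) r, ENNReal.ofReal (gaussianPDFReal 0 (1 / 2) 1) := by
        rw [setLIntegral_const, Real.volume_Ioo, ← ENNReal.ofReal_mul hM]
        ring_nf
    _ ≤ _ := by
        refine setLIntegral_mono' measurableSet_Ioo fun x hx => ENNReal.ofReal_le_ofReal ?_
        have : x ^ 2 ≤ 1 := by
          rw [sq_le_one_iff_abs_le_one, abs_le]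
          exact ⟨by linarith [hx.1], by linarith [hx.2]⟩
        unfold gaussianPDFReal
        refine mul_le_mul_of_nonneg_left (Real.exp_le_exp.2 ?_) (by positivity)
        norm_num
        exact (sq_le_one_iff_abs_le_one x).1 this

theorem complexGaussian_real_apply (S : Set ℂ) :
    complexGaussian.real S = ((gaussianReal 0 (1 / 2)).prod (gaussianReal 0 (1 / 2))).real
      {x | (⟨x.1, x.2⟩ : ℂ) ∈ S} := by
  rw [measureReal_def, complexGaussian, MeasurableEquiv.map_apply]
  rfl

/-- The probability that the fading gain is small is of the order of the gain squared. -/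
theorem complexGaussian_ball_bounds : ∃ c > 0, ∃ C > 0,
    (∀ r, 0 ≤ r → complexGaussian.real {z | ‖z‖ < r} ≤ C * r ^ 2) ∧
      ∀ r, 0 ≤ r → r ≤ 1 → c * r ^ 2 ≤ complexGaussian.real {z | ‖z‖ < r} := by
  have h0 := gaussianPDFReal_pos 0 (1 / 2) 0 (by norm_num)
  have h1 := gaussianPDFReal_pos 0 (1 / 2) 1 (by norm_num)
  refine ⟨gaussianPDFReal 0 (1 / 2) 1 ^ 2, by positivity,
    gaussianPDFReal 0 (1 / 2) 0 ^ 2 * 4, by positivity, fun r hr => ?_, fun r hr hr1 => ?_⟩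
  · rw [complexGaussian_real_apply]
    -- The disc lies in the square of half-side `r`, and contains the one of half-side `r / 2` used
    -- for the lower bound.
    calc _ ≤ ((gaussianReal 0 (1 / 2)).prod (gaussianReal 0 (1 / 2))).real
          (Set.Ioo (-r) r ×ˢ Set.Ioo (-r) r) := by
          refine measureReal_mono fun x hx => ?_
          simp only [Set.mem_ofPred_eq] at hx
          have ha := (Complex.abs_re_le_norm ⟨x.1, x.2⟩).trans_lt hx
          have hb := (Complex.abs_im_le_norm ⟨x.1, x.2⟩).trans_lt hx
          exact ⟨abs_lt.1 ha, abs_lt.1 hb⟩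
      _ ≤ (gaussianPDFReal 0 (1 / 2) 0 * (2 * r)) * (gaussianPDFReal 0 (1 / 2) 0 * (2 * r)) := by
          rw [measureReal_prod_prod]
          have := gaussianReal_Ioo_le hr
          gcongr
      _ = _ := by ring
  · rw [complexGaussian_real_apply]
    calc _ = (gaussianPDFReal 0 (1 / 2) 1 * (2 * (r / 2))) *
          (gaussianPDFReal 0 (1 / 2) 1 * (2 * (r / 2))) := by ring
      _ ≤ ((gaussianReal 0 (1 / 2)).prod (gaussianReal 0 (1 / 2))).real
          (Set.Ioo (-(r / 2)) (r / 2) ×ˢ Set.Ioo (-(r / 2)) (r / 2)) := by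
          rw [measureReal_prod_prod]
          have := le_gaussianReal_Ioo (r := r / 2) (by linarith)
          gcongr
      _ ≤ _ := by
          refine measureReal_mono fun x hx => ?_
          have ha := abs_lt.2 (Set.mem_Ioo.1 hx.1)
          have hb := abs_lt.2 (Set.mem_Ioo.1 hx.2)
          refine (Complex.norm_le_abs_re_add_abs_im ⟨x.1, x.2⟩).trans_lt ?_
          simp only
          linarith

variable {ι : Type*} [Fintype ι]

theorem pi_complexGaussian_real (r : ι → Set ℂ) :
    (Measure.pi fun _ : ι => complexGaussian).real (Set.pi Set.univ r) =
      ∏ i, complexGaussian.real (r i) := by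
  rw [measureReal_def, Measure.pi_pi, ENNReal.toReal_prod]
  rfl

open Classical in
theorem pi_complexGaussian_balls (T : Finset ι) (r : ι → ℝ) :
    (Measure.pi fun _ : ι => complexGaussian).real {h | ∀ i ∈ T, ‖h i‖ < r i} =
      ∏ i ∈ T, complexGaussian.real {z | ‖z‖ < r i} := by
  have : {h : ι → ℂ | ∀ i ∈ T, ‖h i‖ < r i} =
      Set.pi Set.univ fun i => if i ∈ T then {z | ‖z‖ < r i} else Set.univ := by
    ext h
    simp only [Set.mem_ofPred_eq, Set.mem_pi, Set.mem_univ, true_implies]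
    refine forall_congr' fun i => ?_
    split_ifs with hi <;> simp [hi]
  rw [this, pi_complexGaussian_real, ← Finset.prod_subset (Finset.subset_univ T)]
  · exact Finset.prod_congr rfl fun i hi => by rw [if_pos hi]
  · intro i _ hi
    rw [if_neg hi, probReal_univ]

/-- The outage probability of a weighted sum of fading gains over `T` is of the order
`min 1 x ^ #T` in the normalized threshold `x`. -/
theorem fading_sum_bounds (T : Finset ι) (w : ι → ℝ) (hw : ∀ i ∈ T, 0 < w i) {σ : ℝ} (hσ : 0 < σ) :
    ∃ c > 0, ∃ C > 0, ∀ x > 0,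
      c * min 1 x ^ T.card ≤ (Measure.pi fun _ : ι => complexGaussian).real
        {h | (∑ i ∈ T, ‖h i‖ * w i) ^ 2 < σ ^ 2 * x} ∧
      (Measure.pi fun _ : ι => complexGaussian).real
        {h | (∑ i ∈ T, ‖h i‖ * w i) ^ 2 < σ ^ 2 * x} ≤ C * min 1 x ^ T.card := by
  obtain ⟨c, hc, C, hC, hle, hge⟩ := complexGaussian_ball_bounds
  have hW : 0 ≤ ∑ i ∈ T, w i := Finset.sum_nonneg fun i hi => (hw i hi).le
  -- If all gains are below `θ * √e`, the weighted sum stays below `σ * √e`; the cap `1` keeps the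
  -- radius in the range of the lower small-ball estimate.
  set θ : ℝ := min 1 (σ / (1 + ∑ i ∈ T, w i)) with hθ
  have hθ0 : 0 < θ := by positivity
  have hprod : 0 ≤ ∏ i ∈ T, C * (σ / w i) ^ 2 := Finset.prod_nonneg fun i _ => by positivity
  refine ⟨(c * θ ^ 2) ^ T.card, by positivity, max 1 (∏ i ∈ T, C * (σ / w i) ^ 2), by positivity,
    fun x hx => ⟨?_, ?_⟩⟩
  · set e := min 1 x with he
    have he0 : 0 < e := lt_min one_pos hx
    calc _ = ∏ i ∈ T, c * (θ * √e) ^ 2 := by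
          rw [Finset.prod_const, mul_pow θ, Real.sq_sqrt he0.le, ← mul_pow, ← mul_assoc]
      _ ≤ ∏ i ∈ T, complexGaussian.real {z | ‖z‖ < θ * √e} := by
          refine Finset.prod_le_prod (fun i _ => by positivity) fun i _ => hge _ (by positivity) ?_
          exact mul_le_one₀ (min_le_left _ _) (Real.sqrt_nonneg _)
            (Real.sqrt_le_one.2 (min_le_left _ _))
      _ = _ := (pi_complexGaussian_balls T fun _ => θ * √e).symm
      _ ≤ _ := by
          refine measureReal_mono fun h hh => ?_
          simp only [Set.mem_ofPred_eq] at hh ⊢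
          have hs : ∑ i ∈ T, ‖h i‖ * w i < σ * √x := by
            calc ∑ i ∈ T, ‖h i‖ * w i ≤ ∑ i ∈ T, θ * √e * w i := by
                  refine Finset.sum_le_sum fun i hi => ?_
                  have := hw i hi
                  have := hh i hi
                  gcongr
              _ = θ * (∑ i ∈ T, w i) * √e := by rw [← Finset.mul_sum]; ring
              _ < σ * √e := by
                  refine mul_lt_mul_of_pos_right ?_ (Real.sqrt_pos.2 he0)
                  have h1 : θ * (1 + ∑ i ∈ T, w i) ≤ σ := by
                    rw [← le_div_iff₀ (by positivity)]
                    exact min_le_right _ _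
                  nlinarith
              _ ≤ σ * √x := by
                  gcongr
                  exact min_le_right _ _
          have hs0 : 0 ≤ ∑ i ∈ T, ‖h i‖ * w i :=
            Finset.sum_nonneg fun i hi => mul_nonneg (norm_nonneg _) (hw i hi).le
          calc _ < (σ * √x) ^ 2 := by gcongr
            _ = _ := by rw [mul_pow, Real.sq_sqrt hx.le]
  · rcases le_total 1 x with h1 | h1
    · rw [min_eq_left h1, one_pow, mul_one]
      exact measureReal_le_one.trans (le_max_left _ _)
    · rw [min_eq_right h1]
      -- The terms are nonnegative, so a small sum forces every gain to be small, and these events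
      -- are independent.
      calc _ ≤ (Measure.pi fun _ : ι => complexGaussian).real
            {h | ∀ i ∈ T, ‖h i‖ < σ / w i * √x} := by
            refine measureReal_mono fun h hh i hi => ?_
            simp only [Set.mem_ofPred_eq] at hh
            have h2 : ‖h i‖ * w i ≤ ∑ i ∈ T, ‖h i‖ * w i :=
              Finset.single_le_sum (f := fun i => ‖h i‖ * w i)
                (fun i hi => mul_nonneg (norm_nonneg _) (hw i hi).le) hi
            have h3 : ∑ i ∈ T, ‖h i‖ * w i < σ * √x := by
              refine lt_of_pow_lt_pow_left₀ 2 (by positivity) ?_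
              rwa [mul_pow, Real.sq_sqrt hx.le]
            rw [div_mul_eq_mul_div, lt_div_iff₀ (hw i hi)]
            linarith
        _ = ∏ i ∈ T, complexGaussian.real {z | ‖z‖ < σ / w i * √x} :=
            pi_complexGaussian_balls T _
        _ ≤ ∏ i ∈ T, C * (σ / w i) ^ 2 * x := by
            refine Finset.prod_le_prod (fun i _ => measureReal_nonneg) fun i hi => ?_
            have := hw i hi
            refine (hle _ (by positivity)).trans_eq ?_
            rw [mul_pow, Real.sq_sqrt hx.le]
            ring
        _ = (∏ i ∈ T, C * (σ / w i) ^ 2) * x ^ T.card := by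
            rw [Finset.prod_mul_distrib, Finset.prod_const]
        _ ≤ _ := by
            gcongr
            exact le_max_right _ _

end SmallBall

/-! ### Order of the outage probability at a node -/

namespace MyopicNetwork

variable (W : MyopicNetwork)

open Classical in
/-- The nodes transmitting to `j` in the state `s`. -/
noncomputable def transmitters (j : W.Node) (s : W.State) : Finset W.Node :=
  Finset.univ.filter fun i => Transmits s i j

variable {W}

theorem Transmits.lt_and_le {s : W.State} {i j : W.Node} (h : Transmits s i j) :
    i < j ∧ (j : ℕ) ≤ i + W.k := by
  rcases h with ⟨rfl, h1, h2⟩ | ⟨r, n, rfl, h, -, -⟩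
  · simp only [src, Fin.lt_def, Fin.val_zero]
    omega
  · have := n.isLt
    simp only [bufLen] at this
    rw [Fin.lt_def]
    omega

variable (W)

/-- An outage says that the square of the weighted sum of gains is below `σ ^ 2 * (γ / P)`, so
`fading_sum_bounds` applies with threshold `γ / P`. -/
theorem outage_bounds (j : W.Node) (s : W.State) : ∃ c > 0, ∃ C > 0, ∀ P > 0, ∀ γ > 0,
    c * min 1 (γ / P) ^ (W.transmitters j s).card ≤ W.outage P γ j s ∧
      W.outage P γ j s ≤ C * min 1 (γ / P) ^ (W.transmitters j s).card := by
  classical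
  obtain ⟨c, hc, C, hC, h⟩ := fading_sum_bounds (W.transmitters j s)
    (fun i => √(W.d i j ^ (-W.η) * W.a i j)) (fun i hi => by
      simp only [transmitters, Finset.mem_filter, Finset.mem_univ, true_and] at hi
      have := W.d_pos i j hi.lt_and_le.1
      have := W.a_pos i j hi.lt_and_le.1 hi.lt_and_le.2
      positivity) W.σ_pos
  refine ⟨c, hc, C, hC, fun P hP γ hγ => ?_⟩
  have hσ := W.σ_pos
  have : W.outage P γ j s = (Measure.pi fun _ : W.Node => complexGaussian).real
      {h | (∑ i ∈ W.transmitters j s, ‖h i‖ * √(W.d i j ^ (-W.η) * W.a i j)) ^ 2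
        < W.σ ^ 2 * (γ / P)} := by
    unfold outage snr
    congr 1
    ext h
    rw [Set.mem_ofPred_eq, Set.mem_ofPred_eq, transmitters, Finset.sum_filter, div_mul_eq_mul_div,
      div_lt_iff₀ (by positivity), ← mul_div_assoc, lt_div_iff₀ hP, mul_comm P, mul_comm γ]
  rw [this]
  exact h (γ / P) (by positivity)

/-- The outage probability of a node with `t` transmitters is of the order `min 1 (γ / P) ^ t`,
uniformly in the nodes and the states. -/
theorem outage_uniform_bounds : ∃ c > 0, c ≤ 1 ∧ ∃ C > 0, ∀ P > 0, ∀ γ > 0, ∀ j s,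
    c * min 1 (γ / P) ^ (W.transmitters j s).card ≤ W.outage P γ j s ∧
      W.outage P γ j s ≤ C * min 1 (γ / P) ^ (W.transmitters j s).card := by
  choose c hc C hC h using fun x : W.Node × W.State => W.outage_bounds x.1 x.2
  obtain ⟨c₀, hc₀, hle⟩ : ∃ c₀ > 0, ∀ x, c₀ ≤ c x := by
    obtain ⟨x, hx⟩ := Finite.exists_min c
    exact ⟨c x, hc x, hx⟩
  obtain ⟨C₀, hC₀, hge⟩ : ∃ C₀ > 0, ∀ x, C x ≤ C₀ := by
    obtain ⟨x, hx⟩ := Finite.exists_max C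
    exact ⟨C x, hC x, hx⟩
  refine ⟨min 1 c₀, by positivity, min_le_left _ _, C₀, hC₀, fun P hP γ hγ j s => ?_⟩
  have hε : 0 < min 1 (γ / P) := lt_min one_pos (by positivity)
  obtain ⟨h1, h2⟩ := h (j, s) P hP γ hγ
  refine ⟨le_trans ?_ h1, h2.trans ?_⟩
  · gcongr
    exact (min_le_right _ _).trans (hle _)
  · gcongr
    exact hge _

end MyopicNetwork

/-! ### One-step expectations of the Markov chain -/

namespace MyopicNetwork

variable {W : MyopicNetwork}

/-- All dual-mode relays are silent in the state `s`. -/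
def Silent (s : W.State) : Prop := ∀ i, s.1 i = false

/-- The first element of the buffer of relay `r` is non-empty, i.e. the relay has decoded in the
previous time-slot. -/
def fresh (s : W.State) (r : Fin W.N) : Bool := s.2 r ⟨0, W.bufLen_pos r⟩

/-- The state that follows `m`, given the new modes and the new first elements of the buffers. -/
def nextState (m : W.State) (x : W.H → Bool) (y : Fin W.N → Bool) : W.State :=
  (x, fun r n => if h : (n : ℕ) = 0 then y r else m.2 r ⟨n - 1, by omega⟩)

theorem shiftCompatible_nextState (m : W.State) (x : W.H → Bool) (y : Fin W.N → Bool) :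
    ShiftCompatible m (nextState m x y) := by
  intro r n n' h
  simp [nextState, h]

theorem nextState_eq {m l : W.State} (h : ShiftCompatible m l) :
    nextState m l.1 (fresh l) = l := by
  refine Prod.ext rfl ?_
  funext r n
  simp only [nextState, fresh]
  split_ifs with h0
  · have : n = ⟨0, W.bufLen_pos r⟩ := Fin.ext h0
    rw [this]
  · exact (h r ⟨n - 1, by omega⟩ n (by simp only; omega)).symm

/-- The successors of `m` are parametrized bijectively by the new modes and the new first buffer
elements. -/
theorem sum_shiftCompatible [∀ m l : W.State, Decidable (ShiftCompatible m l)] (m : W.State)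
    (G : (W.H → Bool) → (Fin W.N → Bool) → ℝ) :
    ∑ l : W.State, (if ShiftCompatible m l then G l.1 (fresh l) else 0) =
      ∑ x, ∑ y, G x y := by
  rw [← Finset.sum_filter, ← Fintype.sum_prod_type']
  refine Finset.sum_nbij' (fun l => (l.1, fresh l)) (fun x => nextState m x.1 x.2) ?_ ?_ ?_ ?_ ?_
  · simp
  · intro x _
    simpa using shiftCompatible_nextState m x.1 x.2
  · intro l hl
    exact nextState_eq (by simpa using hl)
  · intro x _
    exact Prod.ext rfl (by funext r; simp [nextState, fresh])
  · simp

theorem sum_prod_bool {ι : Type*} [Fintype ι] [DecidableEq ι] (f : ι → Bool → ℝ) :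
    ∑ x : ι → Bool, ∏ i, f i (x i) = ∏ i, (f i true + f i false) := by
  have := Finset.prod_univ_sum (fun _ : ι => (Finset.univ : Finset Bool)) f
  simp only [Fintype.piFinset_univ, Fintype.sum_bool] at this
  exact this.symm

-- Given the present state, modes and decoding results are independent, so expectations of products
-- factor. Indicators as factors yield the event probabilities needed below.
variable (W) in
theorem sum_transitionMatrix_mul_prod (P γ : ℝ) (m : W.State) (u : W.H → Bool → ℝ)
    (v : Fin W.N → Bool → ℝ) :
    ∑ l, W.transitionMatrix P γ l m * ((∏ i, u i (l.1 i)) * ∏ r, v r (fresh l r)) =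
      (∏ i, ((1 - W.q) * u i true + W.q * u i false)) *
        ∏ r, ((1 - W.outage P γ (W.relay r) m) * v r true
          + W.outage P γ (W.relay r) m * v r false) := by
  classical
  have h := sum_shiftCompatible m fun x y =>
    (∏ i, (if x i = true then 1 - W.q else W.q) * u i (x i)) *
      ∏ r, (if y r = true then 1 - W.outage P γ (W.relay r) m
        else W.outage P γ (W.relay r) m) * v r (y r)
  rw [← Finset.sum_mul_sum, sum_prod_bool (fun i b => (if b = true then 1 - W.q else W.q) * u i b),
    sum_prod_bool (fun r b => (if b = true then 1 - W.outage P γ (W.relay r) m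
        else W.outage P γ (W.relay r) m) * v r b)] at h
  simp only [if_true, Bool.false_eq_true, if_false] at h
  rw [← h]
  refine Finset.sum_congr rfl fun l _ => ?_
  unfold transitionMatrix
  split_ifs
  · rw [mul_mul_mul_comm, ← Finset.prod_mul_distrib, ← Finset.prod_mul_distrib]
    simp only [fresh]
    congr!
  · simp

open Classical in
variable (W) in
/-- The probability that no relay of `D` decodes. -/
theorem sum_transitionMatrix_fail (P γ : ℝ) (m : W.State) (D : Finset (Fin W.N)) :
    ∑ l, W.transitionMatrix P γ l m * (if ∀ r ∈ D, fresh l r = false then 1 else 0) =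
      ∏ r ∈ D, W.outage P γ (W.relay r) m := by
  have h := W.sum_transitionMatrix_mul_prod P γ m (fun _ _ => 1)
    (fun r b => if r ∈ D → b = false then 1 else 0)
  simp only [Finset.prod_ite_zero, Finset.prod_const_one, Finset.mem_univ, true_implies,
    one_mul, mul_one, sub_add_cancel] at h
  rw [h, ← Finset.prod_subset (Finset.subset_univ D)]
  · exact Finset.prod_congr rfl fun r hr => by simp [hr]
  · intro r _ hr
    simp [hr]

open Classical in
variable (W) in
/-- The probability that all dual-mode relays become silent and no relay of `D` decodes. -/
theorem sum_transitionMatrix_silent_fail (P γ : ℝ) (m : W.State) (D : Finset (Fin W.N)) :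
    ∑ l, W.transitionMatrix P γ l m *
        (if Silent l ∧ ∀ r ∈ D, fresh l r = false then 1 else 0) =
      W.q ^ W.H.card * ∏ r ∈ D, W.outage P γ (W.relay r) m := by
  have h := W.sum_transitionMatrix_mul_prod P γ m (fun _ b => if b = false then 1 else 0)
    (fun r b => if r ∈ D → b = false then 1 else 0)
  simp only [Finset.prod_ite_zero, Finset.prod_const_one, Finset.mem_univ, true_implies] at h
  convert h using 1
  · refine Finset.sum_congr rfl fun l _ => ?_
    have e : ∀ (p q : Prop) [Decidable p] [Decidable q] [Decidable (p ∧ q)], (if p ∧ q then (1 : ℝ) else 0) =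
        (if p then 1 else 0) * (if q then 1 else 0) := fun p q => by
      intros
      by_cases p <;> by_cases q <;> simp [*]
    rw [e]
    exact congrArg _ (congrArg₂ _ (if_congr Iff.rfl rfl rfl) (if_congr Iff.rfl rfl rfl))
  · rw [← Finset.prod_subset (Finset.subset_univ D)]
    · congr 1
      · simp
      · exact Finset.prod_congr rfl fun r hr => by simp [hr]
    · intro r _ hr
      simp [hr]

variable (W)

theorem outage_nonneg (P γ : ℝ) (j : W.Node) (s : W.State) : 0 ≤ W.outage P γ j s :=
  measureReal_nonneg

theorem outage_le_one (P γ : ℝ) (j : W.Node) (s : W.State) : W.outage P γ j s ≤ 1 :=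
  measureReal_le_one

theorem transitionMatrix_nonneg (P γ : ℝ) (l m : W.State) : 0 ≤ W.transitionMatrix P γ l m := by
  unfold transitionMatrix
  have := W.q_pos
  have := W.q_lt_one
  split_ifs
  · refine mul_nonneg (Finset.prod_nonneg fun i _ => ?_) (Finset.prod_nonneg fun r _ => ?_)
    · split_ifs <;> linarith
    · have := W.outage_nonneg P γ (W.relay r) m
      have := W.outage_le_one P γ (W.relay r) m
      split_ifs <;> linarith
  · exact le_rfl

theorem shiftCompatible_of_transitionMatrix_ne_zero {P γ : ℝ} {l m : W.State}
    (h : W.transitionMatrix P γ l m ≠ 0) : ShiftCompatible m l := by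
  by_contra hc
  exact h (by simp [transitionMatrix, hc])

theorem sum_transitionMatrix (P γ : ℝ) (m : W.State) : ∑ l, W.transitionMatrix P γ l m = 1 := by
  simpa using W.sum_transitionMatrix_fail P γ m ∅

/-- The expectation of `f` after one transition. -/
noncomputable def stepExp (P γ : ℝ) (f : W.State → ℝ) (m : W.State) : ℝ :=
  ∑ l, W.transitionMatrix P γ l m * f l

variable {W}

theorem IsStationary.sum_mul_stepExp {P γ : ℝ} {p : W.State → ℝ}
    (h : IsStationary (W.transitionMatrix P γ) p) (f : W.State → ℝ) :
    ∑ m, p m * W.stepExp P γ f m = ∑ m, p m * f m := by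
  have h2 : ∀ l, p l = ∑ m, W.transitionMatrix P γ l m * p m := fun l =>
    (congrFun h.2.2 l).symm
  simp only [stepExp, Finset.mul_sum]
  rw [Finset.sum_comm]
  refine Finset.sum_congr rfl fun l _ => ?_
  conv_rhs => rw [h2 l, Finset.sum_mul]
  exact Finset.sum_congr rfl fun m _ => by ring

/-! ### Following one packet: failure probabilities and cuts of core links -/

variable (W)

/-- The probability, given the present state, of an outage at the destination `t` slots later. -/
noncomputable def laterOutage (P γ : ℝ) : ℕ → W.State → ℝ
  | 0 => W.outage P γ W.dst
  | t + 1 => W.stepExp P γ (laterOutage P γ t)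

theorem laterOutage_nonneg (P γ : ℝ) : ∀ t s, 0 ≤ W.laterOutage P γ t s
  | 0, s => W.outage_nonneg P γ W.dst s
  | t + 1, s => Finset.sum_nonneg fun l _ =>
    mul_nonneg (W.transitionMatrix_nonneg P γ l s) (laterOutage_nonneg P γ t l)

/-- Stationarity allows the outage to be computed from a state `t` slots earlier. For `t = N` none
of the initial buffer elements concerns the packet any more. -/
theorem systemOutage_eq_laterOutage {P γ : ℝ} {p : W.State → ℝ}
    (h : IsStationary (W.transitionMatrix P γ) p) :
    ∀ t, W.systemOutage P γ p = ∑ m, p m * W.laterOutage P γ t m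
  | 0 => rfl
  | t + 1 => (systemOutage_eq_laterOutage h t).trans (h.sum_mul_stepExp _).symm

/-- The links over which the relays that are always active, and the source, may transmit. -/
def CoreLink (i j : W.Node) : Prop := i < j ∧ (j : ℕ) ≤ i + W.k ∧ ¬ IsDual i

open Classical in
/-- The number of core links from `X` to `j`. -/
noncomputable def coreDeg (X : Finset W.Node) (j : W.Node) : ℕ :=
  (X.filter fun u => W.CoreLink u j).card

theorem cutSize_coreLink (X : Finset W.Node) :
    cutSize W.CoreLink X = ∑ v with v ∉ X, W.coreDeg X v := by
  unfold cutSize coreDeg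
  congr! 1
  ext
  simp

variable {W}

theorem relay_injective : Function.Injective W.relay := by
  intro r r' h
  simp only [relay, Fin.mk.injEq, Nat.add_right_cancel_iff] at h
  exact Fin.ext h

theorem isDual_relay {r : Fin W.N} : IsDual (W.relay r) ↔ r ∈ W.H :=
  ⟨fun ⟨_, h, e⟩ => relay_injective e ▸ h, fun h => ⟨r, h, rfl⟩⟩

theorem relay_ne_src (r : Fin W.N) : W.relay r ≠ W.src := by
  simp [relay, src, Fin.ext_iff]

theorem relay_ne_dst (r : Fin W.N) : W.relay r ≠ W.dst := by
  have := r.isLt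
  simp only [relay, dst, ne_eq, Fin.ext_iff, Fin.val_last]
  omega

theorem not_isDual_src : ¬ IsDual W.src := fun ⟨_, _, h⟩ => relay_ne_src _ h.symm

theorem not_isDual_dst : ¬ IsDual W.dst := fun ⟨_, _, h⟩ => relay_ne_dst _ h.symm

theorem eq_src_or_dst_or_relay (v : W.Node) : v = W.src ∨ v = W.dst ∨ ∃ r, v = W.relay r := by
  rcases Nat.eq_zero_or_pos (v : ℕ) with h | h
  · exact Or.inl (Fin.ext h)
  · by_cases h2 : (v : ℕ) = W.N + 1
    · exact Or.inr (Or.inl (Fin.ext h2))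
    · refine Or.inr (Or.inr ⟨⟨v - 1, by omega⟩, Fin.ext ?_⟩)
      simp only [relay]
      omega

/-- A core link out of a relay comes with an element of its buffer. -/
theorem CoreLink.exists_buffer {r : Fin W.N} {j : W.Node} (h : W.CoreLink (W.relay r) j) :
    ∃ n : Fin (W.bufLen r), (j : ℕ) = W.relay r + (n + 1) := by
  obtain ⟨h1, h2, -⟩ := h
  have hj := j.isLt
  rw [Fin.lt_def] at h1
  simp only [relay] at h1 h2 ⊢
  refine ⟨⟨j - (r + 1) - 1, ?_⟩, ?_⟩
  · simp only [bufLen]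
    omega
  · simp only
    omega

theorem CoreLink.transmits_src {s : W.State} {j : W.Node} (h : W.CoreLink W.src j) :
    Transmits s W.src j := by
  obtain ⟨h1, h2, -⟩ := h
  rw [Fin.lt_def] at h1
  simp only [src, Fin.val_zero] at h1 h2
  exact Or.inl ⟨rfl, by omega, by omega⟩

theorem CoreLink.transmits_relay {s : W.State} {r : Fin W.N} {j : W.Node}
    (h : W.CoreLink (W.relay r) j)
    (hs : ∀ n : Fin (W.bufLen r), (j : ℕ) = W.relay r + (n + 1) → s.2 r n = true) :
    Transmits s (W.relay r) j := by
  obtain ⟨n, hn⟩ := h.exists_buffer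
  exact Or.inr ⟨r, n, rfl, hn, hs n hn, fun hr => absurd (isDual_relay.2 hr) h.2.2⟩

theorem CoreLink.ne_dst {u j : W.Node} (h : W.CoreLink u j) : u ≠ W.dst := by
  rintro rfl
  exact absurd h.1 (Fin.le_last j).not_gt

/-- A silent state only uses core links. -/
theorem Transmits.coreLink {s : W.State} (hs : Silent s) {i j : W.Node} (h : Transmits s i j) :
    W.CoreLink i j := by
  refine ⟨h.lt_and_le.1, h.lt_and_le.2, ?_⟩
  rcases h with ⟨rfl, -⟩ | ⟨r, n, rfl, -, -, h⟩
  · exact not_isDual_src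
  · rw [isDual_relay]
    intro hr
    have := h hr
    rw [hs] at this
    cases this

theorem coreDeg_le_card_transmitters {s : W.State} {X : Finset W.Node} {j : W.Node}
    (h : ∀ r (n : Fin (W.bufLen r)), (j : ℕ) = W.relay r + (n + 1) → W.relay r ∈ X →
      s.2 r n = true) : W.coreDeg X j ≤ (W.transmitters j s).card := by
  classical
  refine Finset.card_le_card fun u hu => ?_
  rw [Finset.mem_filter] at hu
  simp only [transmitters, Finset.mem_filter, Finset.mem_univ, true_and]
  rcases eq_src_or_dst_or_relay u with rfl | rfl | ⟨r, rfl⟩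
  · exact hu.2.transmits_src
  · exact absurd rfl hu.2.ne_dst
  · exact hu.2.transmits_relay fun n hn => h r n hn hu.1

/-- Silence removes the links out of dual-mode relays, and any other relay that sends to `j` has the
relevant buffer element filled, hence lies in `X`. -/
theorem card_transmitters_le_coreDeg {s : W.State} (hs : Silent s) {X : Finset W.Node}
    (hX : W.src ∈ X) {j : W.Node}
    (h : ∀ r (n : Fin (W.bufLen r)), (j : ℕ) = W.relay r + (n + 1) → s.2 r n = true →
      W.relay r ∈ X) : (W.transmitters j s).card ≤ W.coreDeg X j := by
  classical
  refine Finset.card_le_card fun u hu => ?_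
  simp only [transmitters, Finset.mem_filter, Finset.mem_univ, true_and] at hu
  rw [Finset.mem_filter]
  refine ⟨?_, hu.coreLink hs⟩
  rcases hu with ⟨rfl, -⟩ | ⟨r, n, rfl, hn, hn', -⟩
  · exact hX
  · exact h r n hn hn'

/-- The relay that decodes `t + 1` slots before the destination. -/
theorem exists_relay_of_lt {t : ℕ} (ht : t < W.N) : ∃ r : Fin W.N, (r : ℕ) + 1 + t = W.N :=
  ⟨⟨W.N - 1 - t, by omega⟩, by simp only; omega⟩

/-- Induction on the number `t` of slots left. Node `N + 1 - t` is receiving the packet, buffer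
elements with `r + n + 2 + t = N + 1` are those holding it, and `X` is the set of earlier nodes that
have it. The power of `ε` on the left accounts for the earlier nodes that failed; with the later
failures it adds up to a full cut, of at least `L` links. -/
theorem laterOutage_mul_le {P γ K ε : ℝ} (hK : 0 ≤ K) (hε : 0 < ε) (hε1 : ε ≤ 1)
    (hub : ∀ j s, W.outage P γ j s ≤ K * ε ^ (W.transmitters j s).card) {L : ℕ}
    (hL : ∀ X : Finset W.Node, W.src ∈ X → W.dst ∉ X → L ≤ cutSize W.CoreLink X) :
    ∀ t ≤ W.N, ∀ (s : W.State) (X : Finset W.Node), W.src ∈ X →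
      (∀ v ∈ X, (v : ℕ) + t < W.N + 1) →
      (∀ r (n : Fin (W.bufLen r)), (r : ℕ) + n + 2 + t = W.N + 1 →
        (s.2 r n = true ↔ W.relay r ∈ X)) →
      W.laterOutage P γ t s *
        ε ^ (∑ v ∈ Finset.univ.filter (fun v : W.Node => (v : ℕ) + t < W.N + 1 ∧ v ∉ X), W.coreDeg X v) ≤
          K * (1 + K) ^ t * ε ^ L
  | 0, _, s, X, hsrc, hX, hagree => by
    have hdX : W.dst ∉ X := fun h => by
      have := hX _ h
      simp [dst] at this
    have hcut : L ≤ W.coreDeg X W.dst +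
        ∑ v ∈ Finset.univ.filter (fun v : W.Node => (v : ℕ) + 0 < W.N + 1 ∧ v ∉ X), W.coreDeg X v := by
      refine (hL X hsrc hdX).trans (le_of_eq ?_)
      rw [cutSize_coreLink, ← Finset.sum_insert (by simp [dst])]
      refine Finset.sum_congr ?_ fun _ _ => rfl
      ext v
      simp only [Finset.mem_filter, Finset.mem_univ, true_and, Finset.mem_insert]
      constructor
      · intro hv
        by_cases h : v = W.dst
        · exact Or.inl h
        · refine Or.inr ⟨?_, hv⟩
          have : (v : ℕ) ≠ W.N + 1 := fun h' => h (Fin.ext h')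
          omega
      · rintro (rfl | h)
        · exact hdX
        · exact h.2
    have hdeg : W.coreDeg X W.dst ≤ (W.transmitters W.dst s).card :=
      coreDeg_le_card_transmitters fun r n hn hr => (hagree r n (by
        simp only [dst, relay, Fin.val_last] at hn
        omega)).2 hr
    calc W.laterOutage P γ 0 s * _ ≤ K * ε ^ W.coreDeg X W.dst * _ := by
          gcongr
          exact (hub _ _).trans (mul_le_mul_of_nonneg_left
            (pow_le_pow_of_le_one hε.le hε1 hdeg) hK)
      _ = K * ε ^ (W.coreDeg X W.dst + _) := by rw [mul_assoc, ← pow_add]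
      _ ≤ K * ε ^ L := mul_le_mul_of_nonneg_left (pow_le_pow_of_le_one hε.le hε1 hcut) hK
      _ = _ := by simp
  | t + 1, ht, s, X, hsrc, hX, hagree => by
    classical
    have ih := laterOutage_mul_le hK hε hε1 hub hL t (by omega)
    obtain ⟨r, hr⟩ := exists_relay_of_lt (W := W) (t := t) (by omega)
    have hrX : W.relay r ∉ X := fun h => by
      have := hX _ h
      simp only [relay] at this
      omega
    set c := ∑ v ∈ Finset.univ.filter (fun v : W.Node => (v : ℕ) + (t + 1) < W.N + 1 ∧ v ∉ X), W.coreDeg X v with hc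
    set M := K * (1 + K) ^ t * ε ^ L with hM
    have hM0 : 0 ≤ M := by positivity
    -- Links go upwards, so adding the latest relay to `X` does not change the degrees of earlier
    -- nodes.
    have hdec : ∀ l, ShiftCompatible s l → fresh l r = true →
        W.laterOutage P γ t l * ε ^ c ≤ M := by
      intro l hl hlr
      have h1 := ih l (insert (W.relay r) X) (Finset.mem_insert_of_mem hsrc) ?_ ?_
      · refine le_trans (mul_le_mul_of_nonneg_left (pow_le_pow_of_le_one hε.le hε1 ?_)
          (W.laterOutage_nonneg P γ t l)) h1
        rw [hc]
        have hsub : ∀ v : W.Node, (v : ℕ) + t < W.N + 1 ∧ v ∉ insert (W.relay r) X →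
            (v : ℕ) + (t + 1) < W.N + 1 ∧ v ∉ X := by
          rintro v ⟨h1, h2⟩
          rw [Finset.mem_insert, not_or] at h2
          refine ⟨?_, h2.2⟩
          have : (v : ℕ) ≠ r + 1 := fun h => h2.1 (Fin.ext h)
          omega
        calc _ ≤ ∑ v ∈ Finset.univ.filter (fun v : W.Node => (v : ℕ) + t < W.N + 1 ∧ v ∉ insert (W.relay r) X), 
                W.coreDeg X v := by
              refine Finset.sum_le_sum fun v hv => ?_
              refine Finset.card_le_card fun u hu => ?_
              simp only [Finset.mem_filter, Finset.mem_insert] at hu ⊢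
              refine ⟨hu.1.resolve_left ?_, hu.2⟩
              rintro rfl
              have h3 := hu.2.1
              have h4 := (hsub v (Finset.mem_filter.1 hv).2).1
              rw [Fin.lt_def] at h3
              simp only [relay] at h3
              omega
          _ ≤ _ := Finset.sum_le_sum_of_subset fun v hv => by
              simp only [Finset.mem_filter, Finset.mem_univ, true_and] at hv ⊢
              exact hsub v hv
      · intro v hv
        rcases Finset.mem_insert.1 hv with rfl | hv
        · simp only [relay]
          omega
        · have := hX v hv
          omega
      · intro r' n' hn
        by_cases h0 : (n' : ℕ) = 0
        · have hrr : r' = r := Fin.ext (by omega)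
          subst hrr
          have : n' = ⟨0, W.bufLen_pos r'⟩ := Fin.ext h0
          subst this
          simpa [fresh] using hlr
        · have hne : W.relay r' ≠ W.relay r := fun h => by
            have := congrArg Fin.val (relay_injective h)
            omega
          rw [hl r' ⟨n' - 1, by omega⟩ n' (by simp only; omega), Finset.mem_insert,
            or_iff_right hne]
          exact hagree r' _ (by simp only; omega)
    -- A failure adds the degree of the relay to the exponent.
    have hfail : ∀ l, ShiftCompatible s l → fresh l r = false →
        W.laterOutage P γ t l * ε ^ (c + W.coreDeg X (W.relay r)) ≤ M := by
      intro l hl hlr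
      have h1 := ih l X hsrc (fun v hv => by have := hX v hv; omega) ?_
      · convert h1 using 3
        rw [add_comm, hc, ← Finset.sum_insert (by simp [relay]; omega)]
        refine Finset.sum_congr ?_ fun _ _ => rfl
        ext v
        simp only [Finset.mem_filter, Finset.mem_univ, true_and, Finset.mem_insert]
        constructor
        · rintro (rfl | h)
          · refine ⟨?_, hrX⟩
            simp only [relay]
            omega
          · exact ⟨by omega, h.2⟩
        · rintro ⟨h2, h3⟩
          by_cases h : v = W.relay r
          · exact Or.inl h
          · refine Or.inr ⟨?_, h3⟩
            have : (v : ℕ) ≠ r + 1 := fun h' => h (Fin.ext h')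
            omega
      · intro r' n' hn
        by_cases h0 : (n' : ℕ) = 0
        · have hrr : r' = r := Fin.ext (by omega)
          subst hrr
          have : n' = ⟨0, W.bufLen_pos r'⟩ := Fin.ext h0
          subst this
          simp only [fresh] at hlr
          simp [hlr, hrX]
        · rw [hl r' ⟨n' - 1, by omega⟩ n' (by simp only; omega)]
          exact hagree r' _ (by simp only; omega)
    set e := ε ^ W.coreDeg X (W.relay r) with he
    have he0 : 0 < e := by positivity
    have hout : W.outage P γ (W.relay r) s ≤ K * e :=
      (hub _ _).trans (mul_le_mul_of_nonneg_left (pow_le_pow_of_le_one hε.le hε1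
        (coreDeg_le_card_transmitters fun r' n hn hr' => (hagree r' n (by
          simp only [relay] at hn
          omega)).2 hr')) hK)
    have hsum := W.sum_transitionMatrix_fail P γ s {r}
    simp only [Finset.mem_singleton, forall_eq, Finset.prod_singleton] at hsum
    calc W.laterOutage P γ (t + 1) s * ε ^ c
        = ∑ l, W.transitionMatrix P γ l s * (W.laterOutage P γ t l * ε ^ c) := by
          rw [laterOutage, stepExp, Finset.sum_mul]
          simp only [mul_assoc]
      -- The loss `1 / e` on failure is compensated by the failure probability, at most `K * e`.
      -- Both outcomes together cost the factor `1 + K` per slot.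
      _ ≤ ∑ l, W.transitionMatrix P γ l s *
            (M + M / e * (if fresh l r = false then 1 else 0)) := by
          refine Finset.sum_le_sum fun l _ => ?_
          by_cases hA : W.transitionMatrix P γ l s = 0
          · simp [hA]
          have hl := W.shiftCompatible_of_transitionMatrix_ne_zero hA
          refine mul_le_mul_of_nonneg_left ?_ (W.transitionMatrix_nonneg P γ l s)
          by_cases hlr : fresh l r = false
          · have := hfail l hl hlr
            rw [pow_add, ← mul_assoc, ← le_div_iff₀ he0] at this
            rw [if_pos hlr]
            linarith
          · rw [if_neg hlr, mul_zero, add_zero]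
            exact hdec l hl (by simpa using hlr)
      _ = M + M / e * W.outage P γ (W.relay r) s := by
          have h1 : (∑ l, W.transitionMatrix P γ l s) * M = M := by
            rw [W.sum_transitionMatrix, one_mul]
          rw [← hsum, Finset.mul_sum]
          conv_rhs => rw [← h1, Finset.sum_mul]
          rw [← Finset.sum_add_distrib]
          refine Finset.sum_congr rfl fun l _ => ?_
          rw [← Finset.sum_mul, h1]
          ring
      _ ≤ M + M / e * (K * e) := by gcongr
      _ = _ := by
          have : M / e * (K * e) = M * K := by field_simp
          rw [this, hM]
          ring

/-- Only histories are counted in which all dual-mode relays stay silent and the relays outside the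
fixed cut `X` fail. Relays in `X` may decode or not, as further failures only remove transmitters;
hence the hypothesis on the buffers is one-sided. -/
theorem mul_le_laterOutage {P γ c ε : ℝ} (hc : 0 < c) (hc1 : c ≤ 1) (hε : 0 < ε) (hε1 : ε ≤ 1)
    (hlb : ∀ j s, c * ε ^ (W.transmitters j s).card ≤ W.outage P γ j s)
    {X : Finset W.Node} (hsrc : W.src ∈ X) (hdst : W.dst ∉ X) :
    ∀ t ≤ W.N, ∀ s : W.State, Silent s →
      (∀ r (n : Fin (W.bufLen r)), (r : ℕ) + n + 2 + t = W.N + 1 →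
        s.2 r n = true → W.relay r ∈ X) →
      c * (W.q ^ W.H.card * c) ^ t *
        ε ^ (∑ v ∈ Finset.univ.filter (fun v : W.Node => W.N + 1 ≤ (v : ℕ) + t ∧ v ∉ X), W.coreDeg X v) ≤
          W.laterOutage P γ t s
  | 0, _, s, hs, hw => by
    have hset : (Finset.univ.filter fun v : W.Node => W.N + 1 ≤ (v : ℕ) + 0 ∧ v ∉ X) =
        {W.dst} := by
      ext v
      simp only [Finset.mem_filter, Finset.mem_univ, true_and, Finset.mem_singleton]
      constructor
      · rintro ⟨h, -⟩
        refine Fin.ext ?_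
        simp only [dst, Fin.val_last]
        omega
      · rintro rfl
        exact ⟨by simp [dst], hdst⟩
    rw [hset, Finset.sum_singleton, pow_zero, mul_one]
    refine le_trans ?_ (hlb W.dst s)
    refine mul_le_mul_of_nonneg_left (pow_le_pow_of_le_one hε.le hε1 ?_) hc.le
    refine card_transmitters_le_coreDeg hs hsrc fun r n hn h => hw r n ?_ h
    simp only [dst, relay, Fin.val_last] at hn
    omega
  | t + 1, ht, s, hs, hw => by
    classical
    have ih := mul_le_laterOutage hc hc1 hε hε1 hlb hsrc hdst t (by omega)
    obtain ⟨r, hr⟩ := exists_relay_of_lt (W := W) (t := t) (by omega)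
    set M := c * (W.q ^ W.H.card * c) ^ t *
      ε ^ (∑ v ∈ Finset.univ.filter (fun v : W.Node => W.N + 1 ≤ (v : ℕ) + t ∧ v ∉ X), W.coreDeg X v) with hM
    have hq := W.q_pos
    have hM0 : 0 ≤ M := by positivity
    -- Only the relay receiving the packet in this slot may be required to fail, and only if it lies
    -- outside `X`.
    set D : Finset (Fin W.N) := if W.relay r ∈ X then ∅ else {r} with hD
    have hgood : ∀ l, ShiftCompatible s l → Silent l → (∀ r ∈ D, fresh l r = false) →
        M ≤ W.laterOutage P γ t l := by
      intro l hl hls hlD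
      refine ih l hls fun r' n' hn hb => ?_
      by_cases h0 : (n' : ℕ) = 0
      · have hrr : r' = r := Fin.ext (by omega)
        subst hrr
        have : n' = ⟨0, W.bufLen_pos r'⟩ := Fin.ext h0
        subst this
        by_contra hX
        have := hlD r' (by simp [hD, hX])
        simp only [fresh] at this
        simp [this] at hb
      · rw [hl r' ⟨n' - 1, by omega⟩ n' (by simp only; omega)] at hb
        exact hw r' _ (by simp only; omega) hb
    have hprob : c * ε ^ (if W.relay r ∈ X then 0 else W.coreDeg X (W.relay r)) ≤
        ∏ r ∈ D, W.outage P γ (W.relay r) s := by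
      rw [hD]
      split_ifs with hX
      · simpa using hc1
      · rw [Finset.prod_singleton]
        refine le_trans ?_ (hlb (W.relay r) s)
        refine mul_le_mul_of_nonneg_left (pow_le_pow_of_le_one hε.le hε1 ?_) hc.le
        refine card_transmitters_le_coreDeg hs hsrc fun r' n hn h => hw r' n ?_ h
        simp only [relay] at hn
        omega
    have hexp : ∑ v ∈ Finset.univ.filter (fun v : W.Node => W.N + 1 ≤ (v : ℕ) + (t + 1) ∧ v ∉ X), W.coreDeg X v =
        (if W.relay r ∈ X then 0 else W.coreDeg X (W.relay r)) +
          ∑ v ∈ Finset.univ.filter (fun v : W.Node => W.N + 1 ≤ (v : ℕ) + t ∧ v ∉ X), W.coreDeg X v := by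
      simp only [Finset.sum_filter]
      rw [← Finset.sum_ite_eq' Finset.univ (W.relay r)
        (fun v => if v ∈ X then 0 else W.coreDeg X v) |>.trans (if_pos (Finset.mem_univ _)),
        ← Finset.sum_add_distrib]
      refine Finset.sum_congr rfl fun v _ => ?_
      by_cases hv : v = W.relay r
      · subst hv
        have h1 : W.N + 1 ≤ (W.relay r : ℕ) + (t + 1) := by simp only [relay]; omega
        have h2 : ¬ W.N + 1 ≤ (W.relay r : ℕ) + t := by simp only [relay]; omega
        by_cases h : W.relay r ∈ X <;> simp [h, h1, h2]
      · have : (v : ℕ) ≠ r + 1 := fun h' => hv (Fin.ext h')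
        have h1 : W.N + 1 ≤ (v : ℕ) + (t + 1) ↔ W.N + 1 ≤ (v : ℕ) + t := by omega
        simp [hv, h1]
    calc _ = M * (W.q ^ W.H.card *
          (c * ε ^ (if W.relay r ∈ X then 0 else W.coreDeg X (W.relay r)))) := by
          rw [hexp, hM, pow_add]
          ring
      _ ≤ M * (W.q ^ W.H.card * ∏ r ∈ D, W.outage P γ (W.relay r) s) := by gcongr
      _ = ∑ l, W.transitionMatrix P γ l s *
            (M * (if Silent l ∧ ∀ r ∈ D, fresh l r = false then 1 else 0)) := by
          rw [← W.sum_transitionMatrix_silent_fail P γ s D, Finset.mul_sum]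
          exact Finset.sum_congr rfl fun l _ => by ring
      _ ≤ ∑ l, W.transitionMatrix P γ l s * W.laterOutage P γ t l := by
          refine Finset.sum_le_sum fun l _ => ?_
          by_cases hA : W.transitionMatrix P γ l s = 0
          · simp [hA]
          have hl := W.shiftCompatible_of_transitionMatrix_ne_zero hA
          refine mul_le_mul_of_nonneg_left ?_ (W.transitionMatrix_nonneg P γ l s)
          split_ifs with h
          · rw [mul_one]
            exact hgood l hl h.1 h.2
          · rw [mul_zero]
            exact W.laterOutage_nonneg P γ t l
      _ = W.laterOutage P γ (t + 1) s := rfl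

/-! ### Order of the outage probability of the system -/

variable (W)

theorem src_ne_dst : W.src ≠ W.dst := by
  simp [src, dst, Fin.ext_iff]

/-- The number of edge-disjoint paths along core links. -/
noncomputable def coreNum : ℕ := numEdgeDisjointPaths W.CoreLink W.src W.dst

/-- The outage probability of the system is of the order of `min 1 (γ / P) ^ L`, where `L` is the
number of edge-disjoint paths along core links. -/
theorem systemOutage_bounds : ∃ c > 0, ∃ C > 0, ∀ P > 0, ∀ γ > 0, ∀ p,
    IsStationary (W.transitionMatrix P γ) p →
      c * min 1 (γ / P) ^ W.coreNum ≤ W.systemOutage P γ p ∧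
        W.systemOutage P γ p ≤ C * min 1 (γ / P) ^ W.coreNum := by
  classical
  obtain ⟨c, hc, hc1, K, hK, hb⟩ := W.outage_uniform_bounds
  obtain ⟨X, hsX, hdX, hXle⟩ := exists_cutSize_le_num (E := W.CoreLink) (fun u v h => h.1)
    W.src_ne_dst
  have hL : ∀ X : Finset W.Node, W.src ∈ X → W.dst ∉ X → W.coreNum ≤ cutSize W.CoreLink X :=
    fun X h1 h2 => (hasEdgeDisjointPaths_num W.CoreLink W.src_ne_dst).le_cutSize h1 h2
  have hq := W.q_pos
  refine ⟨W.q ^ W.H.card * (c * (W.q ^ W.H.card * c) ^ W.N), by positivity,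
    K * (1 + K) ^ W.N, by positivity, fun P hP γ hγ p hp => ?_⟩
  set ε := min 1 (γ / P) with hεdef
  have hε : 0 < ε := lt_min one_pos (by positivity)
  have hε1 : ε ≤ 1 := min_le_left _ _
  constructor
  · rw [W.systemOutage_eq_laterOutage hp (W.N + 1)]
    set M := c * (W.q ^ W.H.card * c) ^ W.N * ε ^ W.coreNum with hM
    have hM0 : 0 ≤ M := by positivity
    have hstep : ∀ s, Silent s → M ≤ W.laterOutage P γ W.N s := by
      intro s hs
      refine le_trans ?_ (mul_le_laterOutage hc hc1 hε hε1 (fun j s => (hb P hP γ hγ j s).1)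
        hsX hdX W.N le_rfl s hs fun r n h => by omega)
      rw [hM]
      gcongr ?_ * ?_
      refine pow_le_pow_of_le_one hε.le hε1 (le_trans ?_ hXle)
      rw [cutSize_coreLink]
      refine Finset.sum_le_sum_of_subset fun v hv => ?_
      simp only [Finset.mem_filter, Finset.mem_univ, true_and] at hv ⊢
      exact hv.2
    have hall : ∀ s, W.q ^ W.H.card * M ≤ W.laterOutage P γ (W.N + 1) s := by
      intro s
      have h := W.sum_transitionMatrix_silent_fail P γ s ∅
      simp only [Finset.notMem_empty, false_imp_iff, implies_true, and_true,
        Finset.prod_empty, mul_one] at h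
      rw [← h, Finset.sum_mul, laterOutage, stepExp]
      refine Finset.sum_le_sum fun l _ => ?_
      rw [mul_assoc]
      refine mul_le_mul_of_nonneg_left ?_ (W.transitionMatrix_nonneg P γ l s)
      split_ifs with hl
      · rw [one_mul]
        exact hstep l hl
      · rw [zero_mul]
        exact W.laterOutage_nonneg P γ _ l
    calc _ = ∑ m, p m * (W.q ^ W.H.card * M) := by
          rw [← Finset.sum_mul, hp.2.1, one_mul, hM]
          ring
      _ ≤ _ := Finset.sum_le_sum fun m _ => mul_le_mul_of_nonneg_left (hall m) (hp.1 m)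
  · rw [W.systemOutage_eq_laterOutage hp W.N]
    have hall : ∀ s, W.laterOutage P γ W.N s ≤ K * (1 + K) ^ W.N * ε ^ W.coreNum := by
      intro s
      -- With `N` slots left only the source precedes the receiving node, so no earlier failures are
      -- charged and the condition on the buffers is vacuous.
      have h := laterOutage_mul_le hK.le hε hε1 (fun j s => (hb P hP γ hγ j s).2) hL W.N le_rfl s
        {W.src} (by simp) (by simp [src]) (fun r n h => by omega)
      have h0 : (Finset.univ.filter fun v : W.Node =>
          (v : ℕ) + W.N < W.N + 1 ∧ v ∉ ({W.src} : Finset W.Node)) = ∅ := by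
        ext v
        simp only [Finset.mem_filter, Finset.mem_univ, true_and, Finset.mem_singleton,
          Finset.notMem_empty, iff_false, not_and, not_not]
        intro hv
        exact Fin.ext (by simp only [src, Fin.val_zero]; omega)
      rw [h0, Finset.sum_empty, pow_zero, mul_one] at h
      exact h
    calc _ ≤ ∑ m, p m * (K * (1 + K) ^ W.N * ε ^ W.coreNum) :=
          Finset.sum_le_sum fun m _ => mul_le_mul_of_nonneg_left (hall m) (hp.1 m)
      _ = _ := by rw [← Finset.sum_mul, hp.2.1, one_mul]

end MyopicNetwork

/-! ### States whose stationary probability does not vanish -/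

namespace MyopicNetwork

variable {W : MyopicNetwork}

/-- The first element is empty exactly when decoding failed in the previous slot; stationarity
identifies the two slots. -/
theorem IsStationary.sum_fresh_eq_false {P γ : ℝ} {p : W.State → ℝ}
    (h : IsStationary (W.transitionMatrix P γ) p) (r : Fin W.N) :
    ∑ m, p m * (if fresh m r = false then 1 else 0) = ∑ m, p m * W.outage P γ (W.relay r) m := by
  classical
  rw [← h.sum_mul_stepExp]
  refine Finset.sum_congr rfl fun m _ => ?_
  have := W.sum_transitionMatrix_fail P γ m {r}
  simp only [Finset.mem_singleton, forall_eq, Finset.prod_singleton] at this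
  rw [stepExp, ← this]

/-- In a stationary distribution all elements of a buffer are empty with the same probability. -/
theorem IsStationary.sum_buffer_eq_false {P γ : ℝ} {p : W.State → ℝ}
    (h : IsStationary (W.transitionMatrix P γ) p) (r : Fin W.N) :
    ∀ (n : ℕ) (hn : n < W.bufLen r), ∑ m, p m * (if m.2 r ⟨n, hn⟩ = false then 1 else 0) =
      ∑ m, p m * W.outage P γ (W.relay r) m
  | 0, _ => h.sum_fresh_eq_false r
  | n + 1, hn => by
    rw [← IsStationary.sum_buffer_eq_false h r n (by omega), ← h.sum_mul_stepExp]
    refine Finset.sum_congr rfl fun m _ => ?_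
    congr 1
    set x : ℝ := if m.2 r ⟨n, by omega⟩ = false then 1 else 0 with hx
    have : W.stepExp P γ (fun l => if l.2 r ⟨n + 1, hn⟩ = false then 1 else 0) m =
        (∑ l, W.transitionMatrix P γ l m) * x := by
      rw [stepExp, Finset.sum_mul]
      refine Finset.sum_congr rfl fun l _ => ?_
      by_cases hA : W.transitionMatrix P γ l m = 0
      · simp [hA]
      have hl := W.shiftCompatible_of_transitionMatrix_ne_zero hA
      rw [hl r ⟨n, by omega⟩ ⟨n + 1, hn⟩ rfl]
    rw [this, W.sum_transitionMatrix, one_mul]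

variable (W) in
/-- A relay that the source reaches along core links rarely fails to decode. -/
theorem exists_sum_outage_le {v : W.Node} (hv : Relation.ReflTransGen W.CoreLink W.src v) :
    ∀ r, v = W.relay r → ∃ C, ∀ P > 0, ∀ γ > 0, ∀ p, IsStationary (W.transitionMatrix P γ) p →
      ∑ m, p m * W.outage P γ (W.relay r) m ≤ C * min 1 (γ / P) := by
  classical
  obtain ⟨_, _, _, K, hK, hb⟩ := W.outage_uniform_bounds
  have hub : ∀ P > 0, ∀ γ > 0, ∀ j s, (W.transmitters j s).Nonempty →
      W.outage P γ j s ≤ K * min 1 (γ / P) := by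
    intro P hP γ hγ j s hne
    have hε : 0 < min 1 (γ / P) := lt_min one_pos (by positivity)
    refine (hb P hP γ hγ j s).2.trans (mul_le_mul_of_nonneg_left ?_ hK.le)
    exact pow_le_of_le_one hε.le (min_le_left _ _) hne.card_pos.ne'
  induction hv with
  | refl => exact fun r hr => absurd hr.symm (relay_ne_src r)
  | @tail u w _ huw ih =>
    rintro r rfl
    rcases eq_src_or_dst_or_relay u with rfl | rfl | ⟨r', rfl⟩
    · refine ⟨K, fun P hP γ hγ p hp => ?_⟩
      calc _ ≤ ∑ m, p m * (K * min 1 (γ / P)) := by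
            refine Finset.sum_le_sum fun m _ => mul_le_mul_of_nonneg_left ?_ (hp.1 m)
            exact hub P hP γ hγ _ _ ⟨W.src, by simpa [transmitters] using huw.transmits_src⟩
        _ = _ := by rw [← Finset.sum_mul, hp.2.1, one_mul]
    · exact absurd rfl huw.ne_dst
    · obtain ⟨C, hC⟩ := ih r' rfl
      obtain ⟨n, hn⟩ := huw.exists_buffer
      refine ⟨K + C, fun P hP γ hγ p hp => ?_⟩
      have hε : 0 < min 1 (γ / P) := lt_min one_pos (by positivity)
      -- Either the preceding relay on the core path has an empty element for this link, which is as
      -- rare as its own outage, or it transmits and an outage has probability of order `ε`.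
      calc _ ≤ ∑ m, p m * (K * min 1 (γ / P) + if m.2 r' n = false then 1 else 0) := by
            refine Finset.sum_le_sum fun m _ => mul_le_mul_of_nonneg_left ?_ (hp.1 m)
            split_ifs with h
            · have := W.outage_le_one P γ (W.relay r) m
              have : 0 ≤ K * min 1 (γ / P) := by positivity
              linarith
            · rw [add_zero]
              refine hub P hP γ hγ _ _ ⟨W.relay r', ?_⟩
              simp only [transmitters, Finset.mem_filter, Finset.mem_univ, true_and]
              refine huw.transmits_relay fun n' hn' => ?_
              have : n' = n := Fin.ext (by omega)
              subst this
              simpa using h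
        _ = K * min 1 (γ / P) + ∑ m, p m * (if m.2 r' n = false then 1 else 0) := by
            simp only [mul_add, Finset.sum_add_distrib]
            rw [← Finset.sum_mul, hp.2.1, one_mul]
        _ ≤ K * min 1 (γ / P) + C * min 1 (γ / P) := by
            gcongr
            rw [hp.sum_buffer_eq_false r' n n.isLt]
            exact hC P hP γ hγ p hp
        _ = _ := by ring

/-- The buffers of all relays that the source reaches along core links are full in `m`. -/
def CoreFull (m : W.State) : Prop :=
  ∀ r, Relation.ReflTransGen W.CoreLink W.src (W.relay r) → ∀ n, m.2 r n = true

/-- The stationary probability of a state that is not full along core links tends to `0`. -/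
theorem coreFull_of_not_tendsto {γ : ℝ → ℝ} (hγ : ∀ᶠ P in atTop, 0 < γ P)
    (hε : Tendsto (fun P => min 1 (γ P / P)) atTop (𝓝 0)) {π : ℝ → W.State → ℝ}
    (hπ : ∀ P > 0, IsStationary (W.transitionMatrix P (γ P)) (π P)) {m : W.State}
    (hm : ¬ Tendsto (fun P => π P m) atTop (𝓝 0)) : CoreFull m := by
  intro r hr n
  by_contra hn
  obtain ⟨C, hC⟩ := W.exists_sum_outage_le hr r rfl
  refine hm (squeeze_zero' ?_ ?_ (by simpa using hε.const_mul C))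
  · filter_upwards [eventually_gt_atTop 0] with P hP using (hπ P hP).1 m
  · filter_upwards [eventually_gt_atTop 0, hγ] with P hP hγP
    refine le_trans ?_ (hC P hP (γ P) hγP _ (hπ P hP))
    rw [← (hπ P hP).sum_buffer_eq_false r n n.isLt]
    have h1 := Finset.single_le_sum
      (f := fun m : W.State => π P m * (if m.2 r n = false then 1 else 0))
      (fun m _ => mul_nonneg ((hπ P hP).1 m) (by split_ifs <;> norm_num)) (Finset.mem_univ m)
    rw [if_pos (by simpa using hn), mul_one] at h1
    exact h1

/-- The silent states have total mass `q ^ #H` for every `P`, and there are finitely many of them.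
-/
theorem exists_silent_not_tendsto {γ : ℝ → ℝ} {π : ℝ → W.State → ℝ}
    (hπ : ∀ P > 0, IsStationary (W.transitionMatrix P (γ P)) (π P)) :
    ∃ m : W.State, Silent m ∧ ¬ Tendsto (fun P => π P m) atTop (𝓝 0) := by
  classical
  by_contra! hno
  have hlim : Tendsto (fun P => ∑ m, π P m * (if Silent m then 1 else 0)) atTop (𝓝 0) := by
    rw [← Finset.sum_const_zero (s := (Finset.univ : Finset W.State))]
    refine tendsto_finsetSum _ fun m _ => ?_
    split_ifs with h
    · simpa using hno m h
    · simp
  have hconst : ∀ P > 0, ∑ m, π P m * (if Silent m then 1 else 0) = W.q ^ W.H.card := by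
    intro P hP
    rw [← (hπ P hP).sum_mul_stepExp]
    have h : ∀ m, W.stepExp P (γ P) (fun l => if Silent l then 1 else 0) m =
        W.q ^ W.H.card := fun m => by
      simpa [stepExp] using W.sum_transitionMatrix_silent_fail P (γ P) m ∅
    simp only [h]
    rw [← Finset.sum_mul, (hπ P hP).2.1, one_mul]
  have hlim' : Tendsto (fun _ : ℝ => W.q ^ W.H.card) atTop (𝓝 0) :=
    hlim.congr' (by filter_upwards [eventually_gt_atTop 0] with P hP using hconst P hP)
  have := tendsto_nhds_unique hlim' tendsto_const_nhds
  have := pow_pos W.q_pos W.H.card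
  linarith

/-- Every vertex of the path is reachable along core links, so relays on it have full buffers. Each
vertex before the destination is the tail of a core link, hence not dual-mode. -/
theorem CoreFull.isChain {m : W.State} (hm : CoreFull m) : ∀ (l : List W.Node) (a : W.Node),
    Relation.ReflTransGen W.CoreLink W.src a → (a :: l).IsChain W.CoreLink →
      (a :: l).getLast? = some W.dst → (a :: l).IsChain (TransmitsSurely m)
  | [], _, _, _, _ => by simp
  | b :: l, a, ha, hc, hl => by
    rw [List.isChain_cons_cons] at hc ⊢
    refine ⟨⟨?_, hc.1.2.2, ?_⟩, CoreFull.isChain hm l b (ha.tail hc.1) hc.2 (by simpa using hl)⟩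
    · rcases eq_src_or_dst_or_relay a with rfl | rfl | ⟨r, rfl⟩
      · exact hc.1.transmits_src
      · exact absurd rfl hc.1.ne_dst
      · exact hc.1.transmits_relay fun n _ => hm r ha n
    · cases l with
      | nil =>
        simp only [List.getLast?_cons_cons, List.getLast?_singleton, Option.some.injEq] at hl
        exact hl ▸ not_isDual_dst
      | cons c l => exact (List.isChain_cons_cons.1 hc.2).1.2.2

theorem CoreFull.isDirectedPath {m : W.State} (hm : CoreFull m) {p : List W.Node}
    (hp : IsDirectedPath W.CoreLink W.src W.dst p) :
    IsDirectedPath (TransmitsSurely m) W.src W.dst p := by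
  obtain ⟨h1, h2, h3, h4⟩ := hp
  cases p with
  | nil => simp at h1
  | cons a l =>
    simp only [List.head?_cons, Option.some.injEq] at h1
    subst h1
    exact ⟨rfl, h2, hm.isChain l _ .refl h3 h2, h4⟩

/-- Omitting the dual-mode relays leaves core links only, and fullness makes every core path to the
destination available. -/
theorem CoreFull.num_transmitsSurely {m : W.State} (hm : CoreFull m) :
    numEdgeDisjointPaths (TransmitsSurely m) W.src W.dst = W.coreNum := by
  refine le_antisymm ?_ ?_
  · exact numEdgeDisjointPaths_mono W.src_ne_dst fun u v h =>
      ⟨h.1.lt_and_le.1, h.1.lt_and_le.2, h.2.1⟩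
  · exact numEdgeDisjointPaths_le_of_path W.src_ne_dst fun p hp => hm.isDirectedPath hp

theorem CoreFull.coreNum_le {m : W.State} (hm : CoreFull m) :
    W.coreNum ≤ numEdgeDisjointPaths (Transmits m) W.src W.dst :=
  hm.num_transmitsSurely.symm.le.trans
    (numEdgeDisjointPaths_mono W.src_ne_dst fun _ _ h => h.1)

theorem Silent.num_transmits_le {m : W.State} (hm : Silent m) :
    numEdgeDisjointPaths (Transmits m) W.src W.dst ≤ W.coreNum :=
  numEdgeDisjointPaths_mono W.src_ne_dst fun _ _ h => h.coreLink hm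

/-! ### Logarithmic asymptotics -/

theorem tendsto_log_div_log {γ : ℝ → ℝ} {γ₀ ρ : ℝ} (hγ₀ : 0 < γ₀) (hγ : ∀ᶠ P in atTop, γ₀ ≤ γ P)
    (hrate : Tendsto (fun P : ℝ => Real.log (1 + γ P) / Real.log P) atTop (𝓝 ρ)) :
    Tendsto (fun P : ℝ => Real.log (γ P) / Real.log P) atTop (𝓝 ρ) := by
  have hdiff : Tendsto (fun P : ℝ => (Real.log (1 + γ P) - Real.log (γ P)) / Real.log P) atTop
      (𝓝 0) := by
    -- As `γ ≥ γ₀`, the difference of the logarithms lies between `0` and `log (1 + γ₀⁻¹)`.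
    refine squeeze_zero' ?_ ?_
      ((tendsto_const_nhds (x := Real.log (1 + γ₀⁻¹))).div_atTop Real.tendsto_log_atTop)
    · filter_upwards [hγ, eventually_gt_atTop 1] with P h hP
      have := Real.log_pos hP
      have := Real.log_le_log (hγ₀.trans_le h) (by linarith : γ P ≤ 1 + γ P)
      exact div_nonneg (by linarith) (by linarith)
    · filter_upwards [hγ, eventually_gt_atTop 1] with P h hP
      have := Real.log_pos hP
      have h0 : 0 < γ P := hγ₀.trans_le h
      gcongr
      rw [← Real.log_div (by positivity) (by positivity), add_div, div_self h0.ne', add_comm,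
        one_div]
      gcongr
  have := hrate.sub hdiff
  rw [sub_zero] at this
  refine this.congr fun P => ?_
  ring

/-- The logarithm turns the minimum with `1` into a minimum with `0`, which is inactive in the limit
because `ρ - 1 ≤ 0`. -/
theorem tendsto_log_min_div_log {γ : ℝ → ℝ} {ρ : ℝ} (hρ : ρ ≤ 1) (hγ : ∀ᶠ P in atTop, 0 < γ P)
    (h : Tendsto (fun P : ℝ => Real.log (γ P) / Real.log P) atTop (𝓝 ρ)) :
    Tendsto (fun P : ℝ => Real.log (min 1 (γ P / P)) / Real.log P) atTop (𝓝 (ρ - 1)) := by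
  have h1 : Tendsto (fun P : ℝ => min 0 (Real.log (γ P) / Real.log P - 1)) atTop
      (𝓝 (min 0 (ρ - 1))) := tendsto_const_nhds.min (h.sub_const 1)
  rw [min_eq_right (by linarith)] at h1
  refine h1.congr' ?_
  filter_upwards [hγ, eventually_gt_atTop 1] with P hg hP
  have hl := Real.log_pos hP
  have hP0 : 0 < P := by linarith
  have hlog : Real.log (γ P / P) = Real.log (γ P) - Real.log P :=
    Real.log_div hg.ne' hP0.ne'
  have hsub : Real.log (γ P) / Real.log P - 1 = Real.log (γ P / P) / Real.log P := by
    rw [hlog, sub_div, div_self hl.ne']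
  rw [hsub]
  rcases le_total 1 (γ P / P) with h1 | h1
  · rw [min_eq_left h1, min_eq_left (div_nonneg (Real.log_nonneg h1) hl.le)]
    simp
  · rw [min_eq_right h1,
      min_eq_right (div_nonpos_of_nonpos_of_nonneg (Real.log_nonpos (by positivity) h1) hl.le)]

/-- The exponent of a quantity of the order of `ε ^ L`. -/
theorem tendsto_neg_log_div_log {S ε : ℝ → ℝ} {c C ρ : ℝ} {L : ℕ} (hc : 0 < c) (hC : 0 < C)
    (hε : ∀ᶠ P in atTop, 0 < ε P) (hS : ∀ᶠ P in atTop, c * ε P ^ L ≤ S P ∧ S P ≤ C * ε P ^ L)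
    (h : Tendsto (fun P : ℝ => Real.log (ε P) / Real.log P) atTop (𝓝 (ρ - 1))) :
    Tendsto (fun P : ℝ => -Real.log (S P) / Real.log P) atTop (𝓝 ((1 - ρ) * L)) := by
  have key : ∀ x : ℝ, Tendsto (fun P : ℝ => -(Real.log x / Real.log P)
      - L * (Real.log (ε P) / Real.log P)) atTop (𝓝 ((1 - ρ) * L)) := by
    intro x
    have h1 := ((tendsto_const_nhds (x := Real.log x)).div_atTop
      Real.tendsto_log_atTop).neg.sub (h.const_mul (L : ℝ))
    convert h1 using 2
    ring
  refine tendsto_of_tendsto_of_tendsto_of_le_of_le' (key C) (key c) ?_ ?_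
  · filter_upwards [hε, hS, eventually_gt_atTop 1] with P hP h1 hP1
    have hl := Real.log_pos hP1
    have h0 : 0 < S P := lt_of_lt_of_le (by positivity) h1.1
    have h2 := Real.log_le_log h0 h1.2
    rw [Real.log_mul hC.ne' (by positivity), Real.log_pow] at h2
    rw [← mul_div_assoc, ← neg_div, ← sub_div]
    gcongr
    linarith
  · filter_upwards [hε, hS, eventually_gt_atTop 1] with P hP h1 hP1
    have hl := Real.log_pos hP1
    have h2 := Real.log_le_log (by positivity) h1.1
    rw [Real.log_mul hc.ne' (by positivity), Real.log_pow] at h2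
    rw [← mul_div_assoc, ← neg_div, ← sub_div]
    gcongr
    linarith

theorem tendsto_zero_of_tendsto_log_div_log {ε : ℝ → ℝ} {a : ℝ} (ha : a < 0)
    (hε : ∀ᶠ P in atTop, 0 < ε P)
    (h : Tendsto (fun P : ℝ => Real.log (ε P) / Real.log P) atTop (𝓝 a)) :
    Tendsto ε atTop (𝓝 0) := by
  have h1 := Real.tendsto_exp_atBot.comp (h.neg_mul_atTop ha Real.tendsto_log_atTop)
  refine h1.congr' ?_
  filter_upwards [hε, eventually_gt_atTop 1] with P hP hP1
  have hl := Real.log_pos hP1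
  rw [Function.comp_apply, div_mul_cancel₀ _ hl.ne', Real.exp_log hP]

end MyopicNetwork

/-! ### The diversity gain -/

theorem theorem2 (W : MyopicNetwork) (ρ : ℝ) (hρ : ρ ∈ Set.Icc (0 : ℝ) 1)
    (γ : ℝ → ℝ) (hγ : ∃ γ₀ > 0, ∀ᶠ P in atTop, γ₀ ≤ γ P)
    (hrate : Tendsto (fun P : ℝ => Real.log (1 + γ P) / Real.log P) atTop (𝓝 ρ))
    (π : ℝ → W.State → ℝ)
    (hπ : ∀ P > 0, MyopicNetwork.IsStationary (W.transitionMatrix P (γ P)) (π P)) :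
    (∀ᶠ P in atTop, 0 < W.systemOutage P (γ P) (π P)) ∧
    (∃ L : ℕ,
      IsLeast {n : ℕ | ∃ m : W.State, ¬ Tendsto (fun P => π P m) atTop (𝓝 0) ∧
        n = numEdgeDisjointPaths (MyopicNetwork.Transmits m) W.src W.dst} L ∧
      Tendsto (fun P => -Real.log (W.systemOutage P (γ P) (π P)) / Real.log P) atTop
        (𝓝 ((1 - ρ) * L))) ∧
    (∃ L : ℕ,
      IsLeast {n : ℕ | ∃ m : W.State, ¬ Tendsto (fun P => π P m) atTop (𝓝 0) ∧
        n = numEdgeDisjointPaths (MyopicNetwork.TransmitsSurely m) W.src W.dst} L ∧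
      Tendsto (fun P => -Real.log (W.systemOutage P (γ P) (π P)) / Real.log P) atTop
        (𝓝 ((1 - ρ) * L))) := by
  obtain ⟨γ₀, hγ₀, hγ⟩ := hγ
  have hγpos : ∀ᶠ P in atTop, 0 < γ P := hγ.mono fun P h => hγ₀.trans_le h
  obtain ⟨c, hc, C, hC, hb⟩ := W.systemOutage_bounds
  have hε : ∀ᶠ P in atTop, 0 < min 1 (γ P / P) := by
    filter_upwards [hγpos, eventually_gt_atTop 0] with P h hP using lt_min one_pos (div_pos h hP)
  have hS : ∀ᶠ P in atTop, c * min 1 (γ P / P) ^ W.coreNum ≤ W.systemOutage P (γ P) (π P) ∧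
      W.systemOutage P (γ P) (π P) ≤ C * min 1 (γ P / P) ^ W.coreNum := by
    filter_upwards [hγpos, eventually_gt_atTop 0] with P h hP
    exact hb P hP (γ P) h _ (hπ P hP)
  have hlog := MyopicNetwork.tendsto_log_min_div_log hρ.2 hγpos
    (MyopicNetwork.tendsto_log_div_log hγ₀ hγ hrate)
  have hlim := MyopicNetwork.tendsto_neg_log_div_log hc hC hε hS hlog
  obtain ⟨m₀, hs₀, hm₀⟩ := MyopicNetwork.exists_silent_not_tendsto hπ
  refine ⟨?_, ?_⟩
  · filter_upwards [hε, hS] with P h1 h2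
    exact lt_of_lt_of_le (by positivity) h2.1
  -- For `ρ = 1`, `ε` need not tend to `0`, but the limit is `0` whatever the minimum is; only its
  -- existence is needed, and `m₀` provides that.
  rcases hρ.2.eq_or_lt with rfl | hρ1
  · simp only [sub_self, zero_mul] at hlim ⊢
    exact ⟨⟨_, ⟨Nat.sInf_mem ⟨_, m₀, hm₀, rfl⟩, fun _ h => Nat.sInf_le h⟩, hlim⟩,
      ⟨_, ⟨Nat.sInf_mem ⟨_, m₀, hm₀, rfl⟩, fun _ h => Nat.sInf_le h⟩, hlim⟩⟩
  · have hε0 := MyopicNetwork.tendsto_zero_of_tendsto_log_div_log (by linarith) hε hlog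
    have hfull : ∀ m, ¬ Tendsto (fun P => π P m) atTop (𝓝 0) → MyopicNetwork.CoreFull m :=
      fun m hm => MyopicNetwork.coreFull_of_not_tendsto hγpos hε0 hπ hm
    refine ⟨⟨W.coreNum, ⟨⟨m₀, hm₀, ?_⟩, ?_⟩, hlim⟩, ⟨W.coreNum, ⟨⟨m₀, hm₀, ?_⟩, ?_⟩, hlim⟩⟩
    -- The state `m₀` is both silent and full, so its instance has exactly `coreNum` disjoint paths
    -- and attains the minimum.
    · exact le_antisymm (hfull m₀ hm₀).coreNum_le hs₀.num_transmits_le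
    · rintro _ ⟨m, hm, rfl⟩
      exact (hfull m hm).coreNum_le
    · exact (hfull m₀ hm₀).num_transmitsSurely.symm
    · rintro _ ⟨m, hm, rfl⟩
      exact (hfull m hm).num_transmitsSurely.symm.le
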